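/- Let $k$ be a field of characteristic zero, let $Q$ be the one loop quiver, with vertex $e$ and loop $a$, and let $A := kQ/\langle Q_2\rangle$ be the quotient of the path algebra by the two-sided ideal generated by the path $a^2$ of length two. For $y\in\{e,a\}$ and $n\ge 0$ let $(a^n,y)$ denote the Hochschild $n$-cochain $A^{\otimes n}\to A$ that sends $x_1\otimes\cdots\otimes x_n$ to $\lambda(x_1)\cdots\lambda(x_n)\,y$, where $\lambda(x)$ is the coefficient of $a$ in $x$ (for $n=0$ this is the element $y$ of $A$). The Gerstenhaber bracket makes $HH^1(A)$ a Lie algebra and every $HH^n(A)$ a Lie module over $HH^1(A)$, with action $x.y=[x,y]$. Then: 1. $HH^1(A)$ is a one dimensional abelian Lie algebra, spanned by the class of the cocycle $(a,a)$; and $HH^n(A)$ is one dimensional for every $n\ge 1$. 2. If $n$ is even, $(a^n,e)$ is a cocycle whose class is nonzero, and for $n>0$ this class spans $HH^n(A)$; in $HH^n(A)$ one has $(a,a).(a^n,e) = -n\,(a^n,e)$. 3. If $n$ is odd, $(a^n,a)$ is a cocycle whose class is nonzero and spans $HH^n(A)$; in $HH^n(A)$ one has $(a,a).(a^n,a) =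 -(n-1)\,(a^n,a)$. 4. $HH^0(A)$ has the basis $(a^0,e)=e$, $(a^0,a)=a$, and $(a,a).(a^0,a)=(a^0,a)$. 5. For every $n\ge 2$, the Lie module $HH^n(A)$ is the one dimensional standard module over the Lie algebra $k=\mathfrak{gl}_1(k)$: there are an isomorphism of Lie algebras $\varphi:HH^1(A)\to k$ and a linear isomorphism $\psi:HH^n(A)\to k$ with $\psi(x.y)=\varphi(x)\psi(y)$ for all $x\in HH^1(A)$, $y\in HH^n(A)$. -/

import Mathlib

noncomputable section

namespace Quiver

universe u v w

/-- The paths of a quiver, of any length and between any two vertices. -/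
abbrev AllPaths (V : Type v) [Quiver.{w} V] : Type (max v w) :=
  Σ i j : V, Path i j

/-- The path algebra `kQ`: the `k`-linear span of the set of paths of `Q`. -/
def PathAlgebra (k : Type u) [Field k] (V : Type v) [Quiver.{w} V] : Type (max u v w) :=
  AllPaths V →₀ k

namespace PathAlgebra

section Basic

variable (k : Type u) [Field k] (V : Type v) [Quiver.{w} V]

instance : AddCommGroup (PathAlgebra k V) := inferInstanceAs (AddCommGroup (AllPaths V →₀ k))

instance : Module k (PathAlgebra k V) := inferInstanceAs (Module k (AllPaths V →₀ k))

variable {V}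

/-- A path as an element of the path algebra. -/
def ofPath {i j : V} (p : Path i j) : PathAlgebra k V :=
  Finsupp.single (⟨i, j, p⟩ : AllPaths V) (1 : k)

/-- The coefficient of a path, as a linear form on the path algebra. -/
def coeff {i j : V} (p : Path i j) : PathAlgebra k V →ₗ[k] k :=
  Finsupp.lapply (⟨i, j, p⟩ : AllPaths V)

variable {k}

/-- The linear map with prescribed values on the paths. -/
def lift {M : Type*} [AddCommGroup M] [Module k M] (f : AllPaths V → M) :
    PathAlgebra k V →ₗ[k] M :=
  Finsupp.linearCombination k f

theorem lift_ofPath {M : Type*} [AddCommGroup M] [Module k M] (f : AllPaths V → M)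
    {i j : V} (p : Path i j) : lift f (ofPath k p) = f ⟨i, j, p⟩ := by
  simp only [lift, ofPath]
  exact (Finsupp.linearCombination_single k (1 : k) _).trans (one_smul _ _)

theorem induction_on {P : PathAlgebra k V → Prop} (x : PathAlgebra k V) (h0 : P 0)
    (hadd : ∀ x y, P x → P y → P (x + y))
    (hpath : ∀ (c : k) (i j : V) (p : Path i j), P (c • ofPath k p)) : P x := by
  refine Finsupp.induction_linear (motive := P) x h0 hadd fun p c => ?_
  have h := hpath c p.1 p.2.1 p.2.2
  have e : (c • ofPath k p.2.2 : PathAlgebra k V) = Finsupp.single p c := by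
    refine (Finsupp.smul_single c p (1 : k)).trans ?_
    rw [smul_eq_mul, mul_one]
  rwa [e] at h

end Basic

section Mul

variable (k : Type u) [Field k] {V : Type v} [Quiver.{w} V] [DecidableEq V]

/-- The product of two paths: their concatenation if it makes sense, and zero otherwise. -/
def mulPath (p q : AllPaths V) : PathAlgebra k V :=
  if h : p.2.1 = q.1 then ofPath k (p.2.2.comp (q.2.2.cast h.symm rfl)) else 0

/-- The bilinear extension of the product of paths. -/
def mulₗ : PathAlgebra k V →ₗ[k] PathAlgebra k V →ₗ[k] PathAlgebra k V :=
  lift fun p => lift fun q => mulPath k p q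

variable {k}

theorem mulₗ_ofPath {i j i' j' : V} (p : Path i j) (q : Path i' j') :
    mulₗ k (ofPath k p) (ofPath k q) = mulPath k ⟨i, j, p⟩ ⟨i', j', q⟩ := by
  rw [mulₗ, lift_ofPath, lift_ofPath]

theorem mulₗ_comp {i j l : V} (p : Path i j) (q : Path j l) :
    mulₗ k (ofPath k p) (ofPath k q) = ofPath k (p.comp q) := by
  simp [mulₗ_ofPath, mulPath]

theorem mulₗ_of_ne {i j i' j' : V} (p : Path i j) (q : Path i' j') (h : j ≠ i') :
    mulₗ k (ofPath k p) (ofPath k q) = 0 := by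
  simp [mulₗ_ofPath, mulPath, h]

theorem mulₗ_assoc (x y z : PathAlgebra k V) :
    mulₗ k (mulₗ k x y) z = mulₗ k x (mulₗ k y z) := by
  induction x using induction_on with
  | h0 => simp
  | hadd x x' hx hx' => simp [hx, hx']
  | hpath a i j p =>
    induction y using induction_on with
    | h0 => simp
    | hadd y y' hy hy' => simp only [map_add, LinearMap.add_apply, hy, hy']
    | hpath b i' j' q =>
      induction z using induction_on with
      | h0 => simp
      | hadd z z' hz hz' => simp only [map_add, hz, hz']
      | hpath c i'' j'' r =>
        simp only [map_smul, LinearMap.smul_apply]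
        congr 3
        by_cases h : j = i'
        · subst h
          by_cases h' : j' = i''
          · subst h'
            simp only [mulₗ_comp, Path.comp_assoc]
          · simp only [mulₗ_comp, mulₗ_of_ne _ _ h', map_zero]
        · by_cases h' : j' = i''
          · subst h'
            simp only [mulₗ_comp, mulₗ_of_ne _ _ h, map_zero, LinearMap.zero_apply]
          · simp only [mulₗ_of_ne _ _ h, mulₗ_of_ne _ _ h', map_zero, LinearMap.zero_apply]

variable (k V) in
/-- The sum of the trivial paths. -/
def unit [Fintype V] : PathAlgebra k V := ∑ i : V, ofPath k (Path.nil : Path i i)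

theorem unit_mulₗ [Fintype V] (x : PathAlgebra k V) : mulₗ k (unit k V) x = x := by
  induction x using induction_on with
  | h0 => simp
  | hadd x y hx hy => simp [hx, hy]
  | hpath c i j p =>
    rw [unit, map_sum, LinearMap.sum_apply, Finset.sum_eq_single i]
    · rw [map_smul, mulₗ_comp, Path.nil_comp]
    · intro b _ hb
      rw [map_smul, mulₗ_of_ne _ _ hb, smul_zero]
    · simp

theorem mulₗ_unit [Fintype V] (x : PathAlgebra k V) : mulₗ k x (unit k V) = x := by
  induction x using induction_on with
  | h0 => simp
  | hadd x y hx hy => simp [hx, hy]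
  | hpath c i j p =>
    rw [unit, map_sum, Finset.sum_eq_single j]
    · rw [map_smul, LinearMap.smul_apply, mulₗ_comp, Path.comp_nil]
    · intro b _ hb
      rw [map_smul, LinearMap.smul_apply, mulₗ_of_ne _ _ hb.symm, smul_zero]
    · simp

variable [Fintype V]

instance : Ring (PathAlgebra k V) :=
  { (inferInstance : AddCommGroup (PathAlgebra k V)) with
    mul := fun x y => mulₗ k x y
    one := unit k V
    left_distrib := fun x y z => map_add (mulₗ k x) y z
    right_distrib := fun x y z => LinearMap.map_add₂ (mulₗ k) x y z
    zero_mul := fun x => LinearMap.map_zero₂ (mulₗ k) x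
    mul_zero := fun x => map_zero (mulₗ k x)
    mul_assoc := mulₗ_assoc
    one_mul := unit_mulₗ
    mul_one := mulₗ_unit }

theorem mul_def (x y : PathAlgebra k V) : x * y = mulₗ k x y := rfl

theorem one_def : (1 : PathAlgebra k V) = ∑ i : V, ofPath k (Path.nil : Path i i) := rfl

instance : Algebra k (PathAlgebra k V) :=
  Algebra.ofModule (fun r x y => LinearMap.map_smul₂ (mulₗ k) r x y)
    (fun r x y => map_smul (mulₗ k x) r y)

end Mul

end PathAlgebra

section RadicalSquareZero

variable (k : Type u) [Field k] (V : Type v) [Quiver.{w} V] [DecidableEq V] [Fintype V]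

/-- The two-sided ideal `<Q_2>` of `kQ` generated by the paths of length two. -/
def pathsTwoIdeal : TwoSidedIdeal (PathAlgebra k V) :=
  TwoSidedIdeal.span {x | ∃ (i j : V) (p : Path i j), p.length = 2 ∧ x = PathAlgebra.ofPath k p}

/-- The monomial algebra of radical square zero `kQ / <Q_2>`. -/
abbrev RadSqZero : Type (max u v w) :=
  PathAlgebra k V ⧸ (pathsTwoIdeal k V).asIdeal

variable {V}

/-- The class in `kQ / <Q_2>` of a path. -/
def RadSqZero.ofPath {i j : V} (p : Path i j) : RadSqZero k V :=
  Ideal.Quotient.mk _ (PathAlgebra.ofPath k p)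

theorem PathAlgebra.coeff_mul_ofPath_mul {i j i' j' : V} (p : Path i j) (hp : p.length < 2)
    (q : Path i' j') (hq : q.length = 2) (x y : PathAlgebra k V) :
    coeff k p (x * ofPath k q * y) = 0 := by
  have single : ∀ {a b : V} (r : Path a b), 2 ≤ r.length → coeff k p (ofPath k r) = 0 := by
    intro a b r hr
    refine Finsupp.single_eq_of_ne ?_
    intro h
    have h' := congrArg (fun t : AllPaths V => t.2.2.length) h
    simp only at h'
    omega
  simp only [mul_def]
  induction x using induction_on with
  | h0 => simp
  | hadd x x' hx hx' => simp only [map_add, LinearMap.add_apply, hx, hx', add_zero]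
  | hpath a u v r =>
    induction y using induction_on with
    | h0 => simp
    | hadd y y' hy hy' => simp only [map_add, hy, hy', add_zero]
    | hpath b u' v' s =>
      simp only [map_smul, LinearMap.smul_apply]
      by_cases h : v = i'
      · subst h
        by_cases h' : j' = u'
        · subst h'
          rw [mulₗ_comp, mulₗ_comp, single, smul_zero, smul_zero]
          simp only [Path.length_comp]
          omega
        · rw [mulₗ_comp, mulₗ_of_ne _ _ h', map_zero, smul_zero, smul_zero]
      · rw [mulₗ_of_ne _ _ h, map_zero, LinearMap.zero_apply, map_zero, smul_zero, smul_zero]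

/-- The elements of `<Q_2>` have no component on the paths of length less than two. -/
theorem PathAlgebra.coeff_eq_zero_of_mem {i j : V} (p : Path i j) (hp : p.length < 2)
    {x : PathAlgebra k V} (hx : x ∈ (pathsTwoIdeal k V).asIdeal) : coeff k p x = 0 := by
  rw [TwoSidedIdeal.mem_asIdeal, pathsTwoIdeal,
    TwoSidedIdeal.mem_span_iff_mem_addSubgroup_closure] at hx
  induction hx using AddSubgroup.closure_induction with
  | mem x hx =>
    obtain ⟨_, ⟨x, -, _, ⟨i', j', q, hq, rfl⟩, rfl⟩, y, -, rfl⟩ := hx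
    exact coeff_mul_ofPath_mul k p hp q hq x y
  | zero => exact map_zero _
  | add x y _ _ hx hy => rw [map_add, hx, hy, add_zero]
  | neg x _ hx => rw [map_neg, hx, neg_zero]

/-- The coefficient of an arrow, as a linear form on `kQ / <Q_2>`. -/
def RadSqZero.arrowCoeff {i j : V} (a : i ⟶ j) : RadSqZero k V →ₗ[k] k :=
  ((pathsTwoIdeal k V).asIdeal.restrictScalars k).liftQ (PathAlgebra.coeff k a.toPath)
    fun _ hx => PathAlgebra.coeff_eq_zero_of_mem k a.toPath (by simp) hx

theorem RadSqZero.arrowCoeff_mk {i j : V} (a : i ⟶ j) (x : PathAlgebra k V) :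
    arrowCoeff k a (Ideal.Quotient.mk _ x) = PathAlgebra.coeff k a.toPath x := rfl

end RadicalSquareZero
end Quiver

namespace Hochschild

universe u v

section Cochains

variable (k : Type u) [Field k] (A : Type v) [Ring A] [Algebra k A]

/-- The Hochschild cochains `C^n(A,A) = Hom_k(A^{⊗n}, A)`, as `n`-linear maps. -/
def Cochain (n : ℕ) : Type v := MultilinearMap k (fun _ : Fin n => A) A

namespace Cochain

variable {k A}

instance (n : ℕ) : AddCommGroup (Cochain k A n) :=
  inferInstanceAs (AddCommGroup (MultilinearMap k (fun _ : Fin n => A) A))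

instance (n : ℕ) : Module k (Cochain k A n) :=
  inferInstanceAs (Module k (MultilinearMap k (fun _ : Fin n => A) A))

instance (n : ℕ) : FunLike (Cochain k A n) (Fin n → A) A :=
  inferInstanceAs (FunLike (MultilinearMap k (fun _ : Fin n => A) A) (Fin n → A) A)

/-- The cochain attached to a multilinear function. -/
def mk {n : ℕ} (F : (Fin n → A) → A)
    (hadd : ∀ [DecidableEq (Fin n)] (x : Fin n → A) (i : Fin n) (a b : A),
      F (Function.update x i (a + b)) = F (Function.update x i a) + F (Function.update x i b))
    (hsmul : ∀ [DecidableEq (Fin n)] (x : Fin n → A) (i : Fin n) (c : k) (a : A),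
      F (Function.update x i (c • a)) = c • F (Function.update x i a)) : Cochain k A n :=
  ({ toFun := F, map_update_add' := hadd, map_update_smul' := hsmul } :
    MultilinearMap k (fun _ : Fin n => A) A)

@[ext]
theorem ext {n : ℕ} {f g : Cochain k A n} (h : ∀ x, f x = g x) : f = g := DFunLike.ext f g h

theorem add_apply {n : ℕ} (f g : Cochain k A n) (x : Fin n → A) : (f + g) x = f x + g x := rfl

theorem sub_apply {n : ℕ} (f g : Cochain k A n) (x : Fin n → A) : (f - g) x = f x - g x := rfl

theorem zero_apply {n : ℕ} (x : Fin n → A) : (0 : Cochain k A n) x = 0 := rfl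

theorem smul_apply {n : ℕ} (c : k) (f : Cochain k A n) (x : Fin n → A) :
    (c • f) x = c • f x := rfl

theorem sum_apply {n : ℕ} {ι : Type*} (s : Finset ι) (f : ι → Cochain k A n) (x : Fin n → A) :
    (∑ i ∈ s, f i) x = ∑ i ∈ s, f i x :=
  map_sum ({ toFun := fun f => f x, map_zero' := rfl, map_add' := fun _ _ => rfl } :
    Cochain k A n →+ A) f s

theorem map_update_add {n : ℕ} [DecidableEq (Fin n)] (f : Cochain k A n) (x : Fin n → A)
    (i : Fin n) (a b : A) : f (Function.update x i (a + b)) =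
      f (Function.update x i a) + f (Function.update x i b) :=
  MultilinearMap.map_update_add f x i a b

theorem map_update_smul {n : ℕ} [DecidableEq (Fin n)] (f : Cochain k A n) (x : Fin n → A)
    (i : Fin n) (c : k) (a : A) : f (Function.update x i (c • a)) =
      c • f (Function.update x i a) :=
  MultilinearMap.map_update_smul f x i c a

theorem cons_add {n : ℕ} (f : Cochain k A (n + 1)) (a b : A) (r : Fin n → A) :
    f (Fin.cons (a + b) r) = f (Fin.cons a r) + f (Fin.cons b r) :=
  MultilinearMap.cons_add f r a b

theorem cons_sub {n : ℕ} (f : Cochain k A (n + 1)) (a b : A) (r : Fin n → A) :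
    f (Fin.cons (a - b) r) = f (Fin.cons a r) - f (Fin.cons b r) := by
  rw [eq_sub_iff_add_eq, ← cons_add, sub_add_cancel]

end Cochain

variable {k A}

/-- The arguments `(x_1, ..., g(x_i, ..., x_{i+m-1}), ..., x_{n+m-1})` of `f ∘_i g`
(the indices start at `0` here). -/
def insertArgs {A : Type v} {n m N : ℕ} (h : N + 1 = n + m) (i : Fin n) (g : (Fin m → A) → A)
    (x : Fin N → A) : Fin n → A := fun j =>
  if _ : j < i then x ⟨j, by omega⟩
  else if _ : j = i then g fun l => x ⟨i + l, by omega⟩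
  else x ⟨j + m - 1, by omega⟩

theorem insertArgs_update_lt {A : Type v} {n m N : ℕ} [DecidableEq (Fin N)] (h : N + 1 = n + m) (i : Fin n)
    (g : (Fin m → A) → A) (x : Fin N → A) (t : Fin N) (ht : (t : ℕ) < i) (z : A) :
    insertArgs h i g (Function.update x t z) =
      Function.update (insertArgs h i g x) ⟨t, by omega⟩ z := by
  funext j
  simp only [insertArgs, Function.update_apply, Fin.ext_iff, Fin.lt_def]
  split_ifs <;> first | rfl | omega | skip
  congr 1
  funext l
  rw [if_neg (by omega)]

theorem insertArgs_update_mid {A : Type v} {n m N : ℕ} [DecidableEq (Fin N)] (h : N + 1 = n + m) (i : Fin n)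
    (g : (Fin m → A) → A) (x : Fin N → A) (t : Fin N) (ht : (i : ℕ) ≤ t) (ht' : (t : ℕ) < i + m)
    (z : A) :
    insertArgs h i g (Function.update x t z) =
      Function.update (insertArgs h i g x) i
        (g (Function.update (fun l : Fin m => x ⟨i + l, by omega⟩) ⟨t - i, by omega⟩ z)) := by
  funext j
  simp only [insertArgs, Function.update_apply, Fin.ext_iff, Fin.lt_def]
  split_ifs <;> first | rfl | omega | skip
  congr 1
  funext l
  simp only [Function.update_apply, Fin.ext_iff]
  congr 1
  apply propext
  constructor <;> intro _ <;> omega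

theorem insertArgs_update_gt {A : Type v} {n m N : ℕ} [DecidableEq (Fin N)] (h : N + 1 = n + m) (i : Fin n)
    (g : (Fin m → A) → A) (x : Fin N → A) (t : Fin N) (ht : (i : ℕ) + m ≤ t) (z : A) :
    insertArgs h i g (Function.update x t z) =
      Function.update (insertArgs h i g x) ⟨t + 1 - m, by omega⟩ z := by
  funext j
  simp only [insertArgs, Function.update_apply, Fin.ext_iff, Fin.lt_def]
  split_ifs <;> first | rfl | omega | skip
  congr 1
  funext l
  rw [if_neg (by omega)]

/-- The partial composition `f ∘_i g` of Hochschild cochains, an element of `C^{n+m-1}(A,A)`. -/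
def comp {n m N : ℕ} (h : N + 1 = n + m) (i : Fin n) (f : Cochain k A n) (g : Cochain k A m) :
    Cochain k A N :=
  Cochain.mk (fun x => f (insertArgs h i g x))
    (by
      intro _ x t y z
      rcases lt_or_ge (t : ℕ) i with ht | ht
      · simp only [insertArgs_update_lt h i g x t ht, f.map_update_add]
      · rcases lt_or_ge (t : ℕ) (i + m) with ht' | ht'
        · simp only [insertArgs_update_mid h i g x t ht ht', g.map_update_add, f.map_update_add]
        · simp only [insertArgs_update_gt h i g x t ht', f.map_update_add])
    (by
      intro _ x t c z
      rcases lt_or_ge (t : ℕ) i with ht | ht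
      · simp only [insertArgs_update_lt h i g x t ht, f.map_update_smul]
      · rcases lt_or_ge (t : ℕ) (i + m) with ht' | ht'
        · simp only [insertArgs_update_mid h i g x t ht ht', g.map_update_smul, f.map_update_smul]
        · simp only [insertArgs_update_gt h i g x t ht', f.map_update_smul])

theorem comp_apply {n m N : ℕ} (h : N + 1 = n + m) (i : Fin n) (f : Cochain k A n)
    (g : Cochain k A m) (x : Fin N → A) : comp h i f g x = f (insertArgs h i g x) := rfl

/-- `f ∘ g = ∑ (-1)^{(i-1)(m-1)} f ∘_i g`, the sum being over `i = 1, ..., n`. The index starts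
at `0` here, and `m - 1` is replaced with `m + 1`, which has the same parity. -/
def circ {n m N : ℕ} (h : N + 1 = n + m) (f : Cochain k A n) (g : Cochain k A m) :
    Cochain k A N :=
  ∑ i : Fin n, (-1 : k) ^ ((i : ℕ) * (m + 1)) • comp h i f g

/-- The Gerstenhaber bracket `[f, g] = f ∘ g - (-1)^{(n-1)(m-1)} g ∘ f` of cochains. -/
def bracket {n m N : ℕ} (h : N + 1 = n + m) (f : Cochain k A n) (g : Cochain k A m) :
    Cochain k A N :=
  circ h f g - (-1 : k) ^ ((n + 1) * (m + 1)) • circ (h.trans (Nat.add_comm n m)) g f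

variable (k A) in
/-- The multiplication of `A` as a `2`-cochain. -/
def mulCochain : Cochain k A 2 := MultilinearMap.mkPiAlgebraFin k 2 A

theorem mulCochain_apply (x : Fin 2 → A) : mulCochain k A x = x 0 * x 1 :=
  (MultilinearMap.mkPiAlgebraFin_apply x).trans (by simp [List.ofFn_succ])

/-- The Hochschild differential
`δf(x_1, ..., x_{n+1}) = x_1 f(x_2, ..., x_{n+1}) + ∑ (-1)^i f(x_1, ..., x_i x_{i+1}, ..., x_{n+1})
+ (-1)^{n+1} f(x_1, ..., x_n) x_{n+1}`, see `d_apply`. -/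
def dFun {n : ℕ} (f : Cochain k A n) : Cochain k A (n + 1) :=
  comp (by omega : n + 1 + 1 = 2 + n) 1 (mulCochain k A) f
    + ∑ i : Fin n, (-1 : k) ^ ((i : ℕ) + 1) • comp (by omega : n + 1 + 1 = n + 2) i f (mulCochain k A)
    + (-1 : k) ^ (n + 1) • comp (by omega : n + 1 + 1 = 2 + n) 0 (mulCochain k A) f

theorem dFun_apply {n : ℕ} (f : Cochain k A n) (x : Fin (n + 1) → A) :
    dFun f x = x 0 * f (Fin.tail x)
      + ∑ i : Fin n, (-1 : k) ^ ((i : ℕ) + 1) • f (Fin.contractNth i.castSucc (· * ·) x)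
      + (-1 : k) ^ (n + 1) • (f (Fin.init x) * x (Fin.last n)) := by
  simp only [dFun, Cochain.add_apply, Cochain.sum_apply, Cochain.smul_apply,
    comp_apply, mulCochain_apply]
  congr 1
  · congr 1
    · congr 1
      simp only [insertArgs]
      rw [dif_neg (by decide), dif_pos (by decide)]
      congr 1
      funext l
      simp only [Fin.tail]
      congr 1
      ext
      simp [Nat.add_comm]
    · refine Finset.sum_congr rfl fun i _ => ?_
      congr 2
      funext j
      simp only [insertArgs, Fin.contractNth, Fin.lt_def, Fin.ext_iff]
      split_ifs <;> first | rfl | (exfalso; simp at *; omega) | skip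
      rw [mulCochain_apply]
      congr 1
      all_goals congr 1
      all_goals (ext; simp; omega)
  · congr 1
    congr 1
    · simp only [insertArgs]
      rw [dif_neg (by decide), dif_pos (by decide)]
      congr 1
      funext l
      simp only [Fin.init]
      congr 1
      ext
      simp
    · simp only [insertArgs]
      rw [dif_neg (by decide), dif_neg (by decide)]
      congr 1
      ext
      simp 


variable (k) in
/-- The formula for the differential, on arbitrary functions of `n` variables. -/
def dPre {n : ℕ} (F : (Fin n → A) → A) (x : Fin (n + 1) → A) : A :=
  x 0 * F (Fin.tail x)
    + ∑ i : Fin n, (-1 : k) ^ ((i : ℕ) + 1) • F (Fin.contractNth i.castSucc (· * ·) x)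
    + (-1 : k) ^ (n + 1) • (F (Fin.init x) * x (Fin.last n))

theorem contractNth_zero_cons {n : ℕ} (x₀ x₁ : A) (r : Fin n → A) :
    Fin.contractNth (n := n + 1) 0 (· * ·) (Fin.cons x₀ (Fin.cons x₁ r : Fin (n + 1) → A)) =
      (Fin.cons (x₀ * x₁) r : Fin (n + 1) → A) := by
  funext j
  refine Fin.cases ?_ (fun j => ?_) j
  · rw [Fin.contractNth_apply_of_eq _ _ _ _ (by simp)]
    rfl
  · rw [Fin.contractNth_apply_of_gt _ _ _ _ (by simp)]
    rfl

theorem contractNth_succ_cons {n : ℕ} (x₀ : A) (i : Fin (n + 1)) (y : Fin (n + 1) → A) :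
    Fin.contractNth i.succ (· * ·) (Fin.cons x₀ y : Fin (n + 2) → A) =
      (Fin.cons x₀ (Fin.contractNth i (· * ·) y) : Fin (n + 1) → A) := by
  funext j
  refine Fin.cases ?_ (fun j => ?_) j
  · rw [Fin.contractNth_apply_of_lt _ _ _ _ (by simp)]
    rfl
  · rw [Fin.cons_succ]
    simp only [Fin.contractNth, Fin.val_succ, add_lt_add_iff_right, add_left_inj]
    rfl

theorem init_cons' {A : Type v} {n : ℕ} (x₀ : A) (y : Fin (n + 1) → A) :
    Fin.init (Fin.cons x₀ y : Fin (n + 2) → A) = (Fin.cons x₀ (Fin.init y) : Fin (n + 1) → A) := by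
  funext j
  refine Fin.cases ?_ (fun j => ?_) j
  · rfl
  · rfl

theorem dPre_zero (F : (Fin 0 → A) → A) (x : Fin 1 → A) :
    dPre k F x = x 0 * F Fin.elim0 - F Fin.elim0 * x 0 := by
  have h1 : Fin.tail x = Fin.elim0 := Subsingleton.elim _ _
  have h2 : Fin.init x = Fin.elim0 := Subsingleton.elim _ _
  simp [dPre, h1, h2, sub_eq_add_neg]

theorem dPre_succ {n : ℕ} (F : (Fin (n + 1) → A) → A) (x₀ x₁ : A) (r : Fin n → A) :
    dPre k F (Fin.cons x₀ (Fin.cons x₁ r : Fin (n + 1) → A)) =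
      x₀ * F (Fin.cons x₁ r) - F (Fin.cons (x₀ * x₁) r) + x₁ * F (Fin.cons x₀ r)
        - dPre k (fun y : Fin n → A => F (Fin.cons x₀ y)) (Fin.cons x₁ r) := by
  have hl : (Fin.cons x₀ (Fin.cons x₁ r : Fin (n + 1) → A) : Fin (n + 2) → A) (Fin.last (n + 1))
      = (Fin.cons x₁ r : Fin (n + 1) → A) (Fin.last n) := rfl
  simp only [dPre, Fin.sum_univ_succ, Fin.castSucc_zero, contractNth_zero_cons, init_cons', hl,
    Fin.cons_zero, Fin.tail_cons, ← Fin.succ_castSucc, contractNth_succ_cons, Fin.val_zero,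
    Fin.val_succ, pow_succ, pow_zero, mul_neg, mul_one, neg_smul, one_smul, neg_neg,
    Finset.sum_neg_distrib]
  abel

/-- The action of an endomorphism `D` on functions of `n` variables. -/
def actPre {n : ℕ} (D : A →+ A) (F : (Fin n → A) → A) (x : Fin n → A) : A :=
  D (F x) - ∑ i, F (Function.update x i (D (x i)))

theorem actPre_zero (D : A →+ A) (F : (Fin 0 → A) → A) (x : Fin 0 → A) :
    actPre D F x = D (F x) := by
  simp [actPre]

theorem actPre_succ {n : ℕ} (D : A →+ A) (F : (Fin (n + 1) → A) → A) (x₀ : A) (r : Fin n → A) :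
    actPre D F (Fin.cons x₀ r) =
      actPre D (fun y : Fin n → A => F (Fin.cons x₀ y)) r - F (Fin.cons (D x₀) r) := by
  simp only [actPre, Fin.sum_univ_succ, Fin.cons_zero, Fin.cons_succ, Fin.update_cons_zero,
    ← Fin.cons_update]
  abel

theorem actPre_sub {n : ℕ} (D : A →+ A) (F G : (Fin n → A) → A) (x : Fin n → A) :
    actPre D (fun y => F y - G y) x = actPre D F x - actPre D G x := by
  simp only [actPre, map_sub, Finset.sum_sub_distrib]
  abel

theorem dPre_sub {n : ℕ} (F G : (Fin n → A) → A) (x : Fin (n + 1) → A) :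
    dPre k (fun y => F y - G y) x = dPre k F x - dPre k G x := by
  simp only [dPre, mul_sub, sub_mul, smul_sub, Finset.sum_sub_distrib]
  abel

/-- The cochain obtained by fixing the first argument. -/
def fixFirst {n : ℕ} (f : Cochain k A (n + 1)) (a : A) : Cochain k A n :=
  MultilinearMap.curryLeft f a

theorem fixFirst_apply {n : ℕ} (f : Cochain k A (n + 1)) (a : A) (r : Fin n → A) :
    fixFirst f a r = f (Fin.cons a r) := rfl

/-- The action of a derivation commutes with the differential. -/
theorem actPre_dPre (D : A →+ A) (hD : ∀ a b, D (a * b) = a * D b + D a * b) {n : ℕ}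
    (f : Cochain k A n) (x : Fin (n + 1) → A) :
    actPre D (dPre k f) x = dPre k (actPre D f) x := by
  induction n with
  | zero =>
    simp only [actPre, dPre_zero, Fin.sum_univ_succ, Fin.sum_univ_zero, Function.update_self, hD,
      map_sub, sub_zero, add_zero]
    abel
  | succ n ih =>
    refine Fin.consCases (fun x₀ y => ?_) x
    refine Fin.consCases (fun x₁ r => ?_) y
    have e1 : (fun y : Fin n → A => actPre D f (Fin.cons x₀ y)) =
        fun y => actPre D (fixFirst f x₀) y - fixFirst f (D x₀) y := by
      funext y
      rw [actPre_succ]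
      rfl
    rw [dPre_succ, e1, dPre_sub, ← ih (fixFirst f x₀), actPre, Fin.sum_univ_succ,
      Fin.sum_univ_succ]
    simp only [Fin.cons_zero, Fin.cons_succ, Fin.update_cons_zero, ← Fin.cons_update, dPre_succ]
    simp only [actPre, Fin.sum_univ_succ, Fin.cons_zero, Fin.cons_succ, Fin.update_cons_zero,
      ← Fin.cons_update, map_sub, map_add, hD, mul_sub, mul_add, Finset.mul_sum, Cochain.cons_add,
      Finset.sum_sub_distrib, Finset.sum_add_distrib]
    simp only [show ∀ a, (fun y : Fin n → A => f (Fin.cons a y)) = fixFirst f a from fun _ => rfl]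
    abel


theorem actPre_comm (D D' : A →+ A) {n : ℕ} (f : Cochain k A n) (x : Fin n → A) :
    actPre (D.comp D' - D'.comp D) f x =
      actPre D (actPre D' f) x - actPre D' (actPre D f) x := by
  induction n with
  | zero => simp only [actPre_zero, AddMonoidHom.sub_apply, AddMonoidHom.comp_apply]
  | succ n ih =>
    refine Fin.consCases (fun x₀ r => ?_) x
    have e' : ∀ a, (fun y : Fin n → A => f (Fin.cons a y)) = fixFirst f a := fun _ => rfl
    simp only [actPre_succ, e', actPre_sub, ih, AddMonoidHom.sub_apply, AddMonoidHom.comp_apply,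
      Cochain.cons_sub]
    abel

variable (k) in
/-- The alternating sum of the insertions of `a`, on arbitrary functions. -/
def hPre (a : A) {n : ℕ} (F : (Fin (n + 1) → A) → A) (x : Fin n → A) : A :=
  ∑ i : Fin (n + 1), (-1 : k) ^ (i : ℕ) • F (Fin.insertNth i a x)

theorem hPre_zero (a : A) (F : (Fin 1 → A) → A) (x : Fin 0 → A) :
    hPre k a F x = F (Fin.cons a x) := by
  simp [hPre, Fin.insertNth_zero']

theorem hPre_succ (a : A) {n : ℕ} (F : (Fin (n + 2) → A) → A) (x₀ : A) (r : Fin n → A) :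
    hPre k a F (Fin.cons x₀ r) =
      F (Fin.cons a (Fin.cons x₀ r : Fin (n + 1) → A))
        - hPre k a (fun y : Fin (n + 1) → A => F (Fin.cons x₀ y)) r := by
  have e : ∀ i : Fin (n + 1), Fin.insertNth i.succ a (Fin.cons x₀ r : Fin (n + 1) → A) =
      (Fin.cons x₀ (Fin.insertNth i a r : Fin (n + 1) → A) : Fin (n + 2) → A) := by
    intro i
    rw [Fin.insertNth_eq_iff]
    refine ⟨by simp, ?_⟩
    funext j
    refine Fin.cases ?_ (fun j => ?_) j <;> simp [Fin.removeNth]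
  simp only [hPre]
  rw [Fin.sum_univ_succ]
  simp only [e, Fin.insertNth_zero', Fin.val_zero, Fin.val_succ, pow_succ, pow_zero, one_smul,
    mul_neg, mul_one, neg_smul, Finset.sum_neg_distrib, sub_eq_add_neg]

theorem hPre_sub (a : A) {n : ℕ} (F G : (Fin (n + 1) → A) → A) (x : Fin n → A) :
    hPre k a (fun y => F y - G y) x = hPre k a F x - hPre k a G x := by
  simp only [hPre, smul_sub, Finset.sum_sub_distrib]

theorem hPre_add (a : A) {n : ℕ} (F G : (Fin (n + 1) → A) → A) (x : Fin n → A) :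
    hPre k a (fun y => F y + G y) x = hPre k a F x + hPre k a G x := by
  simp only [hPre, smul_add, Finset.sum_add_distrib]

theorem hPre_mul (a b : A) {n : ℕ} (F : (Fin (n + 1) → A) → A) (x : Fin n → A) :
    hPre k a (fun y => b * F y) x = b * hPre k a F x := by
  simp only [hPre, Finset.mul_sum, mul_smul_comm]

/-- Inner derivations act by zero up to homotopy. -/
theorem homotopy (a : A) (D : A →+ A) (hD : ∀ b, D b = b * a - a * b) {n : ℕ}
    (f : Cochain k A (n + 1)) (x : Fin (n + 1) → A) :
    actPre D f x = - (dPre k (hPre k a f) x + hPre k a (dPre k f) x) := by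
  induction n with
  | zero =>
    refine Fin.consCases (fun x₀ r => ?_) x
    obtain rfl : r = Fin.elim0 := Subsingleton.elim _ _
    simp only [hPre_succ, hPre_zero, dPre_zero, dPre_succ, actPre_succ, actPre_zero, hD, Cochain.cons_sub,
      Fin.cons_zero]
    abel
  | succ n ih =>
    refine Fin.consCases (fun x₀ y => ?_) x
    refine Fin.consCases (fun x₁ r => ?_) y
    have e' : ∀ b, (fun y : Fin (n + 1) → A => f (Fin.cons b y)) = fixFirst f b := fun _ => rfl
    have e'' : ∀ b c, (fun y : Fin n → A => f (Fin.cons b (Fin.cons c y : Fin (n + 1) → A))) =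
        fixFirst (fixFirst f b) c := fun _ _ => rfl
    have e1 : (fun y : Fin n → A => hPre k a f (Fin.cons x₀ y)) =
        fun y => fixFirst (fixFirst f a) x₀ y - hPre k a (fixFirst f x₀) y := by
      funext y
      rw [hPre_succ]
      rfl
    have e3 : hPre k a (fun y : Fin (n + 2) → A => dPre k f (Fin.cons x₀ y)) (Fin.cons x₁ r) =
        x₀ * hPre k a f (Fin.cons x₁ r) - f (Fin.cons (x₀ * a) (Fin.cons x₁ r : Fin (n + 1) → A))
          + hPre k a (fixFirst f (x₀ * x₁)) r
          + a * f (Fin.cons x₀ (Fin.cons x₁ r : Fin (n + 1) → A))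
          - x₁ * hPre k a (fixFirst f x₀) r
          - hPre k a (dPre k (fixFirst f x₀)) (Fin.cons x₁ r) := by
      rw [hPre_succ, hPre_succ a (dPre k (fixFirst f x₀)), hPre_succ a f, dPre_succ]
      have e4 : (fun y : Fin (n + 1) → A =>
          dPre k f (Fin.cons x₀ (Fin.cons x₁ y : Fin (n + 2) → A))) = fun y =>
            x₀ * fixFirst f x₁ y - fixFirst f (x₀ * x₁) y + x₁ * fixFirst f x₀ y
              - dPre k (fixFirst f x₀) (Fin.cons x₁ y) := by
        funext y
        rw [dPre_succ]
        rfl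
      rw [e4, hPre_sub, hPre_add, hPre_sub, hPre_mul, hPre_mul]
      simp only [e', mul_sub]
      abel
    rw [actPre_succ, e', ih, dPre_succ, e1, dPre_sub, hPre_succ a (dPre k f) x₀, e3, dPre_succ,
      e', dPre_succ (fixFirst f a)]
    simp only [hPre_succ, e', mul_sub, hD, Cochain.cons_sub, fixFirst_apply, e'']
    abel


theorem dPre_left_mul (a : A) {n : ℕ} (F : (Fin n → A) → A) (x : A) (r : Fin n → A) :
    dPre k (fun y => a * F y) (Fin.cons x r) =
      a * dPre k F (Fin.cons x r) + (x * a - a * x) * F r := by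
  simp only [dPre, Fin.cons_zero, Fin.tail_cons, mul_add, Finset.mul_sum, mul_smul_comm, sub_mul,
    mul_assoc]
  abel

theorem dPre_add {n : ℕ} (F G : (Fin n → A) → A) (x : Fin (n + 1) → A) :
    dPre k (fun y => F y + G y) x = dPre k F x + dPre k G x := by
  simp only [dPre, mul_add, add_mul, smul_add, Finset.sum_add_distrib]
  abel

theorem dPre_dPre {n : ℕ} (F : (Fin n → A) → A) (x : Fin (n + 2) → A) :
    dPre k (dPre k F) x = 0 := by
  induction n with
  | zero =>
    refine Fin.consCases (fun x₀ y => ?_) x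
    refine Fin.consCases (fun x₁ r => ?_) y
    simp only [dPre_succ, dPre_zero, Fin.cons_zero, mul_sub, sub_mul, mul_assoc]
    abel
  | succ n ih =>
    refine Fin.consCases (fun x₀ y => ?_) x
    refine Fin.consCases (fun x₁ z => ?_) y
    refine Fin.consCases (fun x₂ r => ?_) z
    have e4 : (fun y : Fin n → A =>
        dPre k F (Fin.cons x₀ (Fin.cons x₁ y : Fin (n + 1) → A))) = fun y =>
          x₀ * F (Fin.cons x₁ y) - F (Fin.cons (x₀ * x₁) y) + x₁ * F (Fin.cons x₀ y)
            - dPre k (fun y => F (Fin.cons x₀ y)) (Fin.cons x₁ y) := by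
      funext y
      rw [dPre_succ]
    have h := ih (fun y => F (Fin.cons x₀ y)) (Fin.cons x₁ (Fin.cons x₂ r : Fin (n + 1) → A))
    rw [dPre_succ] at h
    rw [dPre_succ, dPre_succ (fun y : Fin (n + 1) → A => dPre k F (Fin.cons x₀ y)), e4, dPre_sub,
      dPre_add, dPre_sub, dPre_left_mul, dPre_left_mul]
    simp only [dPre_succ F]
    rw [← h]
    simp only [mul_sub, mul_add, sub_mul, mul_assoc]
    abel

theorem dFun_eq_dPre {n : ℕ} (f : Cochain k A n) (x : Fin (n + 1) → A) :
    dFun f x = dPre k f x := dFun_apply f x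

variable (k A) in
/-- The Hochschild differential `δ : C^n(A,A) → C^{n+1}(A,A)`. -/
def d (n : ℕ) : Cochain k A n →ₗ[k] Cochain k A (n + 1) where
  toFun := dFun
  map_add' f g := by
    ext x
    simp only [Cochain.add_apply, dFun_eq_dPre]
    exact dPre_add f g x
  map_smul' c f := by
    ext x
    simp only [Cochain.smul_apply, dFun_apply, mul_smul_comm, smul_mul_assoc, smul_add, Finset.smul_sum,
      RingHom.id_apply]
    congr 1
    · congr 1
      exact Finset.sum_congr rfl fun i _ => smul_comm _ _ _
    · exact smul_comm _ _ _

theorem d_apply {n : ℕ} (f : Cochain k A n) (x : Fin (n + 1) → A) :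
    d k A n f x = x 0 * f (Fin.tail x)
      + ∑ i : Fin n, (-1 : k) ^ ((i : ℕ) + 1) • f (Fin.contractNth i.castSucc (· * ·) x)
      + (-1 : k) ^ (n + 1) • (f (Fin.init x) * x (Fin.last n)) := dFun_apply f x

theorem d_eq_dPre {n : ℕ} (f : Cochain k A n) : ⇑(d k A n f) = dPre k f :=
  funext fun x => dFun_eq_dPre f x

variable (k A) in
theorem d_comp_d (n : ℕ) : d k A (n + 1) ∘ₗ d k A n = 0 := by
  ext f x
  rw [LinearMap.comp_apply, d_eq_dPre, d_eq_dPre, dPre_dPre]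
  rfl

variable (k A) in
/-- The cocycles of degree `n`. -/
def cocycles (n : ℕ) : Submodule k (Cochain k A n) := LinearMap.ker (d k A n)

variable (k A) in
/-- The coboundaries of degree `n`. -/
def coboundaries : (n : ℕ) → Submodule k (Cochain k A n)
  | 0 => ⊥
  | n + 1 => LinearMap.range (d k A n)

variable (k A) in
theorem coboundaries_le_cocycles (n : ℕ) : coboundaries k A n ≤ cocycles k A n := by
  cases n with
  | zero => exact bot_le
  | succ n => exact LinearMap.range_le_ker_iff.mpr (d_comp_d k A n)

variable (k A) in
/-- The Hochschild cohomology group `HH^n(A)`: cocycles modulo coboundaries. -/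
def HH (n : ℕ) : Type v := cocycles k A n ⧸ (coboundaries k A n).submoduleOf (cocycles k A n)

instance (n : ℕ) : AddCommGroup (HH k A n) :=
  inferInstanceAs (AddCommGroup
    (cocycles k A n ⧸ (coboundaries k A n).submoduleOf (cocycles k A n)))

instance (n : ℕ) : Module k (HH k A n) :=
  inferInstanceAs (Module k
    (cocycles k A n ⧸ (coboundaries k A n).submoduleOf (cocycles k A n)))

/-- The cohomology class of a cocycle. -/
def HH.mk {n : ℕ} : cocycles k A n →ₗ[k] HH k A n :=
  ((coboundaries k A n).submoduleOf (cocycles k A n)).mkQ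

theorem HH.mk_surjective {n : ℕ} : Function.Surjective (HH.mk : cocycles k A n → HH k A n) :=
  Submodule.mkQ_surjective _

theorem HH.mk_eq_zero_iff {n : ℕ} (z : cocycles k A n) :
    HH.mk z = 0 ↔ (z : Cochain k A n) ∈ coboundaries k A n :=
  Submodule.Quotient.mk_eq_zero _

theorem update_const_one {A : Type v} (b c : A) :
    Function.update (fun _ : Fin 1 => b) 0 c = fun _ => c := by
  funext i
  rw [Subsingleton.elim i 0, Function.update_self]

/-- A `1`-cochain as an additive endomorphism. -/
def toEnd (f : Cochain k A 1) : A →+ A where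
  toFun a := f fun _ => a
  map_zero' := f.map_coord_zero 0 rfl
  map_add' a b := by
    have h := f.map_update_add (fun _ => 0) 0 a b
    simpa only [update_const_one] using h

theorem toEnd_apply (f : Cochain k A 1) (a : A) : toEnd f a = f fun _ => a := rfl

/-- The bracket with a `1`-cochain `f`:
`[f, g](x_1, ..., x_n) = f(g(x_1, ..., x_n)) - ∑ g(x_1, ..., f(x_i), ..., x_n)`. -/
theorem bracket_one_apply {n : ℕ} (h : n + 1 = 1 + n) (f : Cochain k A 1) (g : Cochain k A n)
    (x : Fin n → A) :
    bracket h f g x = actPre (toEnd f) g x := by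
  have s : ∀ j : ℕ, (-1 : k) ^ (j * (1 + 1)) = 1 := fun j => by
    rw [mul_comm, pow_mul]
    norm_num
  have s' : (-1 : k) ^ ((1 + 1) * (n + 1)) = 1 := by
    rw [mul_comm]
    exact s _
  simp only [bracket, circ, s, s', one_smul, Cochain.sub_apply, Cochain.sum_apply, Fin.sum_univ_succ,
    Fin.sum_univ_zero, comp_apply, actPre, add_zero, toEnd_apply,
    Fin.val_zero, zero_mul, pow_zero]
  congr 1
  · congr 1
    funext j
    rw [Subsingleton.elim j 0]
    simp [insertArgs]
  · refine Finset.sum_congr rfl fun i _ => ?_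
    congr 1
    funext j
    simp only [insertArgs, Function.update_apply, Fin.lt_def]
    split_ifs with h1 h2 h2
    · exact absurd h1 (by simp [h2])
    · rfl
    · congr 1
      funext l
      congr 1
      ext
      simp
    · congr 1

theorem dPre_one (f : Cochain k A 1) (a b : A) :
    dPre k f (Fin.cons a (Fin.cons b Fin.elim0 : Fin 1 → A)) =
      a * toEnd f b - toEnd f (a * b) + toEnd f a * b := by
  have e : ∀ c : A, (Fin.cons c Fin.elim0 : Fin 1 → A) = fun _ => c := by
    intro c
    funext i
    refine Fin.cases rfl (fun j => j.elim0) i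
  rw [dPre_succ, dPre_zero]
  simp only [e, toEnd_apply]
  abel

theorem mem_cocycles {n : ℕ} (f : Cochain k A n) :
    f ∈ cocycles k A n ↔ ∀ x, dPre k f x = 0 := by
  rw [cocycles, LinearMap.mem_ker]
  constructor
  · intro h x
    rw [← d_eq_dPre, h, Cochain.zero_apply]
  · intro h
    ext x
    rw [d_eq_dPre, h, Cochain.zero_apply]

/-- A `1`-cocycle is a derivation. -/
theorem toEnd_mul {f : Cochain k A 1} (hf : f ∈ cocycles k A 1) (a b : A) :
    toEnd f (a * b) = a * toEnd f b + toEnd f a * b := by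
  have h := (mem_cocycles f).mp hf (Fin.cons a (Fin.cons b Fin.elim0 : Fin 1 → A))
  rw [dPre_one] at h
  rw [← sub_eq_zero, ← neg_eq_zero, ← h]
  abel

variable (k A) in
/-- The Gerstenhaber bracket `C^1(A,A) × C^n(A,A) → C^n(A,A)`, as a bilinear map. -/
def bracketOne (n : ℕ) : Cochain k A 1 →ₗ[k] Cochain k A n →ₗ[k] Cochain k A n :=
  LinearMap.mk₂ k (fun f g => bracket (Nat.add_comm n 1) f g)
    (fun f f' g => by
      ext x
      simp only [Cochain.add_apply, bracket_one_apply, actPre, toEnd_apply,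
        Cochain.map_update_add, Finset.sum_add_distrib]
      abel)
    (fun c f g => by
      ext x
      simp only [Cochain.smul_apply, bracket_one_apply, actPre, toEnd_apply,
        Cochain.map_update_smul, Finset.smul_sum, smul_sub])
    (fun f g g' => by
      ext x
      simp only [Cochain.add_apply, bracket_one_apply, actPre, map_add, Finset.sum_add_distrib]
      abel)
    (fun c f g => by
      ext x
      have h : ∀ a, toEnd f (c • a) = c • toEnd f a := by
        intro a
        have h := f.map_update_smul (fun _ => 0) 0 c a
        simpa only [update_const_one, toEnd_apply] using h
      simp only [Cochain.smul_apply, bracket_one_apply, actPre, h, Finset.smul_sum, smul_sub])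

theorem bracketOne_apply {n : ℕ} (f : Cochain k A 1) (g : Cochain k A n) :
    bracketOne k A n f g = bracket (Nat.add_comm n 1) f g := rfl

theorem coe_bracketOne {n : ℕ} (f : Cochain k A 1) (g : Cochain k A n) :
    ⇑(bracketOne k A n f g) = actPre (toEnd f) g :=
  funext fun x => bracket_one_apply _ f g x

theorem bracketOne_d {n : ℕ} {f : Cochain k A 1} (hf : f ∈ cocycles k A 1) (g : Cochain k A n) :
    bracketOne k A (n + 1) f (d k A n g) = d k A n (bracketOne k A n f g) := by
  ext x
  rw [coe_bracketOne, d_eq_dPre, d_eq_dPre, coe_bracketOne]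
  exact actPre_dPre (toEnd f) (toEnd_mul hf) g x

theorem bracketOne_mem_cocycles {n : ℕ} {f : Cochain k A 1} (hf : f ∈ cocycles k A 1)
    {g : Cochain k A n} (hg : g ∈ cocycles k A n) : bracketOne k A n f g ∈ cocycles k A n := by
  rw [cocycles, LinearMap.mem_ker] at hg ⊢
  rw [← bracketOne_d hf, hg, map_zero]

theorem bracketOne_mem_coboundaries {n : ℕ} {f : Cochain k A 1} (hf : f ∈ cocycles k A 1)
    {g : Cochain k A n} (hg : g ∈ coboundaries k A n) :
    bracketOne k A n f g ∈ coboundaries k A n := by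
  cases n with
  | zero =>
    obtain rfl : g = 0 := hg
    rw [map_zero]
    exact Submodule.zero_mem _
  | succ n =>
    obtain ⟨g, rfl⟩ := hg
    exact ⟨bracketOne k A n f g, (bracketOne_d hf g).symm⟩

/-- An element of `A` as a `0`-cochain. -/
def ofElem (a : A) : Cochain k A 0 :=
  Cochain.mk (fun _ => a) (fun _ i => i.elim0) (fun _ i => i.elim0)

/-- The alternating sum of the insertions of `a`, on cochains. -/
def hCochain {n : ℕ} (a : A) (f : Cochain k A (n + 1)) : Cochain k A n :=
  ∑ i : Fin (n + 1), (-1 : k) ^ (i : ℕ) • comp (m := 0) rfl i f (ofElem a)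

theorem coe_hCochain {n : ℕ} (a : A) (f : Cochain k A (n + 1)) :
    ⇑(hCochain a f) = hPre k a f := by
  funext x
  simp only [hCochain, hPre, Cochain.sum_apply, Cochain.smul_apply, comp_apply]
  refine Finset.sum_congr rfl fun i _ => ?_
  congr 2
  symm
  rw [Fin.insertNth_eq_iff]
  constructor
  · simp [insertArgs]
    rfl
  · funext j
    simp only [Fin.removeNth, insertArgs]
    rcases lt_or_ge (j : ℕ) i with hj | hj
    · rw [Fin.succAbove_of_castSucc_lt _ _ hj, dif_pos (show j.castSucc < i from hj)]
      rfl
    · rw [Fin.succAbove_of_le_castSucc _ _ hj, dif_neg, dif_neg]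
      · rfl
      · simp only [Fin.ext_iff, Fin.val_succ]
        omega
      · simp only [Fin.lt_def, Fin.val_succ]
        omega

theorem bracketOne_inner {n : ℕ} {f : Cochain k A 1} (hf : f ∈ coboundaries k A 1)
    {g : Cochain k A n} (hg : g ∈ cocycles k A n) :
    bracketOne k A n f g ∈ coboundaries k A n := by
  obtain ⟨c, rfl⟩ := hf
  have hD : ∀ b, toEnd (d k A 0 c) b = b * c Fin.elim0 - c Fin.elim0 * b := by
    intro b
    rw [toEnd_apply, d_eq_dPre, dPre_zero]
  cases n with
  | zero =>
    have h : bracketOne k A 0 (d k A 0 c) g = 0 := by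
      ext x
      obtain rfl : x = Fin.elim0 := Subsingleton.elim _ _
      have h := (mem_cocycles g).mp hg fun _ => c Fin.elim0
      rw [dPre_zero] at h
      rw [coe_bracketOne, actPre_zero, hD, Cochain.zero_apply, ← neg_eq_zero, ← h]
      abel
    rw [h]
    exact Submodule.zero_mem _
  | succ n =>
    refine ⟨- hCochain (c Fin.elim0) g, ?_⟩
    ext x
    have hg' : dPre k g = fun _ => 0 := funext ((mem_cocycles g).mp hg)
    rw [map_neg, coe_bracketOne, homotopy (c Fin.elim0) _ hD, hg', ← coe_hCochain, ← d_eq_dPre,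
      neg_add, show hPre k (c Fin.elim0) (fun _ => (0 : A)) x = 0 by simp [hPre], neg_zero,
      add_zero]
    rfl

variable (k A) in
/-- The bracket of a `1`-cocycle and an `n`-cocycle. -/
def bracketCocycles (n : ℕ) : cocycles k A 1 →ₗ[k] cocycles k A n →ₗ[k] cocycles k A n :=
  LinearMap.mk₂ k
    (fun f g => ⟨bracketOne k A n f g, bracketOne_mem_cocycles f.2 g.2⟩)
    (fun f f' g => Subtype.ext (by simp))
    (fun c f g => Subtype.ext (by simp))
    (fun f g g' => Subtype.ext (by simp))
    (fun c f g => Subtype.ext (by simp))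

theorem coe_bracketCocycles {n : ℕ} (f : cocycles k A 1) (g : cocycles k A n) :
    (bracketCocycles k A n f g : Cochain k A n) =
      bracket (Nat.add_comm n 1) (f : Cochain k A 1) (g : Cochain k A n) := rfl

variable (k A) in
/-- The Gerstenhaber bracket `HH^1(A) × HH^n(A) → HH^n(A)`. -/
def bracketHH (n : ℕ) : HH k A 1 →ₗ[k] HH k A n →ₗ[k] HH k A n :=
  (Submodule.liftQ _
    (Submodule.liftQ _ ((bracketCocycles k A n).compr₂ HH.mk) (by
      intro f hf
      ext g
      exact (HH.mk_eq_zero_iff _).mpr (bracketOne_inner hf g.2))).flip (by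
    intro g hg
    rw [LinearMap.mem_ker]
    refine LinearMap.ext fun x => ?_
    obtain ⟨f, rfl⟩ := HH.mk_surjective x
    exact (HH.mk_eq_zero_iff _).mpr (bracketOne_mem_coboundaries f.2 hg))).flip

theorem bracketHH_mk {n : ℕ} (f : cocycles k A 1) (g : cocycles k A n) :
    bracketHH k A n (HH.mk f) (HH.mk g) = HH.mk (bracketCocycles k A n f g) := rfl

theorem bracketHH_self (x : HH k A 1) : bracketHH k A 1 x x = 0 := by
  obtain ⟨f, rfl⟩ := HH.mk_surjective x
  rw [bracketHH_mk]
  have h : bracketCocycles k A 1 f f = 0 := by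
    apply Subtype.ext
    ext x
    rw [coe_bracketCocycles, bracket, show (1 + 1) * (1 + 1) = 2 * 2 from rfl, pow_mul]
    simp [Cochain.zero_apply]
  rw [h, map_zero]

theorem bracketHH_leibniz {n : ℕ} (x y : HH k A 1) (z : HH k A n) :
    bracketHH k A n x (bracketHH k A n y z) =
      bracketHH k A n (bracketHH k A 1 x y) z + bracketHH k A n y (bracketHH k A n x z) := by
  obtain ⟨f, rfl⟩ := HH.mk_surjective x
  obtain ⟨g, rfl⟩ := HH.mk_surjective y
  obtain ⟨h, rfl⟩ := HH.mk_surjective z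
  simp only [bracketHH_mk, ← map_add]
  congr 1
  apply Subtype.ext
  ext x
  change bracketOne k A n f (bracketOne k A n g h) x =
    bracketOne k A n (bracketOne k A 1 f g) h x + bracketOne k A n g (bracketOne k A n f h) x
  have e : toEnd (bracketOne k A 1 f g) =
      (toEnd f.1).comp (toEnd g.1) - (toEnd g.1).comp (toEnd f.1) := by
    ext a
    rw [toEnd_apply, coe_bracketOne]
    simp [actPre, toEnd_apply, update_const_one]
  rw [coe_bracketOne, coe_bracketOne, coe_bracketOne, coe_bracketOne, coe_bracketOne, e,
    actPre_comm]
  abel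

end Cochains

section LieStructure

variable {k : Type u} [Field k] {A : Type v} [Ring A] [Algebra k A]

/-- `HH^1(A)` with the Gerstenhaber bracket. -/
instance : LieRing (HH k A 1) where
  bracket x y := bracketHH k A 1 x y
  add_lie x y z := LinearMap.map_add₂ _ x y z
  lie_add _ y z := map_add _ y z
  lie_self := bracketHH_self
  leibniz_lie := bracketHH_leibniz

instance : LieAlgebra k (HH k A 1) where
  lie_smul c x y := map_smul (bracketHH k A 1 x) c y

/-- The action of `HH^1(A)` on `HH^n(A)` given by the Gerstenhaber bracket. -/
instance (n : ℕ) : LieRingModule (HH k A 1) (HH k A n) where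
  bracket x y := bracketHH k A n x y
  add_lie x y z := LinearMap.map_add₂ _ x y z
  lie_add _ y z := map_add _ y z
  leibniz_lie := bracketHH_leibniz

instance (n : ℕ) : LieModule k (HH k A 1) (HH k A n) where
  smul_lie c x y := LinearMap.map_smul₂ _ c x y
  lie_smul c x y := map_smul (bracketHH k A n x) c y

theorem HH.lie_mk {n : ℕ} (f : cocycles k A 1) (g : cocycles k A n) :
    ⁅HH.mk f, HH.mk g⁆ = HH.mk (bracketCocycles k A n f g) := rfl

end LieStructure

end Hochschild

section LoopQuiver

open Quiver Hochschild

universe u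

variable (k : Type u) [Field k]

/-- The algebra `kQ / <Q_2>` of the one loop quiver `Q`, which has one vertex and one arrow. -/
abbrev LoopAlgebra : Type u := RadSqZero k (SingleObj Unit)

/-- The vertex `e` of the one loop quiver, in `kQ / <Q_2>`. -/
def loopE : LoopAlgebra k :=
  RadSqZero.ofPath k (Path.nil : Path (SingleObj.star Unit) (SingleObj.star Unit))

/-- The loop `a` of the one loop quiver, in `kQ / <Q_2>`. -/
def loopA : LoopAlgebra k :=
  RadSqZero.ofPath k (SingleObj.toHom ()).toPath

/-- The coefficient of the loop `a` in an element of `kQ / <Q_2>`. This is the projection on the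
Jacobson radical, which is `k a`. -/
def loopCoeff : LoopAlgebra k →ₗ[k] k :=
  RadSqZero.arrowCoeff k (SingleObj.toHom ())

/-- The Hochschild cochain represented by the pair of parallel paths `(a^n, y)`, where `y` is `e`
or `a`: it vanishes as soon as one of the arguments is `e`, and its value on `(a, ..., a)` is `y`.
In other words it is the composition of the projections on the radical `r = k a` with the map
`r^{⊗n} → A` which sends `a ⊗ ... ⊗ a` to `y`. -/
def loopCochain (n : ℕ) (y : LoopAlgebra k) : Cochain k (LoopAlgebra k) n :=
  ((MultilinearMap.mkPiAlgebra k (Fin n) k).compLinearMap fun _ => loopCoeff k).smulRight y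

theorem loopCochain_apply (n : ℕ) (y : LoopAlgebra k) (x : Fin n → LoopAlgebra k) :
    loopCochain k n y x = (∏ i, loopCoeff k (x i)) • y := rfl

end LoopQuiver

end

open Hochschild

/-! ### The algebra with basis `1`, `a` and relation `a * a = 0` -/

section LoopAlgebra

open Quiver

variable (k : Type*) [Field k]

/-! Write `A` for the algebra, `v` and `λ` for the coordinates on the basis `1`, `a`. The core is
that every cocycle of positive degree is, up to a coboundary, some `(a^n, y)`. Subtracting from a
cocycle `f` the differential of `f(1, ...)` removes the `v` part of the first slot and leaves `λ(x₀)
c(r)`, so one would like to induct on `c`. But `c` is not a cocycle: moving the differential past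
`λ` changes the sign of the left action of `a`. The induction therefore runs over the differentials
`dTwist ε`, whose left action is twisted by the automorphism `a ↦ ε a`; each step replaces `ε` by
`-ε`, and `ε = 1` is the Hochschild case. The carrying lemmas are `dTwist_loopCup`,
`dTwist_fixFirst_loopA` and `exists_eq_dTwist_add_loopCochain`.

On the cochains that remain, the differential is `(a^n, y) ↦ (1 - (-1)^n) (a^(n+1), a y)`
(`d_loopCochain`). In characteristic zero it sends `(a^n, e)`, for `n` odd, to a nonzero multiple of
`(a^(n+1), a)`, and these two cancel in cohomology. What survives in positive degree is `(a^n, e)`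
for `n` even and `(a^n, a)` for `n` odd. That the survivors are not coboundaries is seen on the
argument `(a, ..., a)`, where `d_apply_loopA` computes every coboundary.

The derivation `(a, a)` is the Euler derivation: it acts on `(a^n, y)` by the degree of `y` (`0` for
`e`, `1` for `a`) minus `n`. This scalar is nonzero for `n ≥ 2`, and rescaling a coordinate on
`HH^1(A)` by it gives the standard module. -/

/-- The coefficient of the vertex `e` in an element of `kQ / <Q_2>`. -/
noncomputable def vertexCoeff : LoopAlgebra k →ₗ[k] k :=
  ((pathsTwoIdeal k (SingleObj Unit)).asIdeal.restrictScalars k).liftQ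
    (PathAlgebra.coeff k (Path.nil : Path (SingleObj.star Unit) (SingleObj.star Unit)))
    fun _ hx => PathAlgebra.coeff_eq_zero_of_mem k _ (by simp) hx

theorem loopE_eq_one : loopE k = 1 := by
  rw [loopE, RadSqZero.ofPath, ← map_one (Ideal.Quotient.mk _), PathAlgebra.one_def]
  congr 1
  exact (Fintype.sum_unique (fun i : SingleObj Unit =>
    PathAlgebra.ofPath k (Path.nil : Path i i))).symm

@[simp]
theorem vertexCoeff_one : vertexCoeff k 1 = 1 := by
  rw [← loopE_eq_one]
  exact Finsupp.single_eq_same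

@[simp]
theorem loopCoeff_loopA : loopCoeff k (loopA k) = 1 := Finsupp.single_eq_same

@[simp]
theorem loopCoeff_one : loopCoeff k 1 = 0 := by
  rw [← loopE_eq_one]
  refine Finsupp.single_eq_of_ne fun h => ?_
  have h' := congrArg (fun t : AllPaths (SingleObj Unit) => t.2.2.length) h
  simp at h'

@[simp]
theorem vertexCoeff_loopA : vertexCoeff k (loopA k) = 0 := by
  refine Finsupp.single_eq_of_ne fun h => ?_
  have h' := congrArg (fun t : AllPaths (SingleObj Unit) => t.2.2.length) h
  simp at h'

/-- The ideal is generated by the paths of length exactly two; a longer path lies in it because its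
last two arrows split off as a right factor. -/
theorem RadSqZero.ofPath_eq_zero {V : Type*} [Quiver V] [DecidableEq V] [Fintype V] {i j : V}
    (p : Path i j) (hp : 2 ≤ p.length) : RadSqZero.ofPath k p = 0 := by
  cases p with
  | nil => simp at hp
  | cons p b =>
    cases p with
    | nil => simp at hp
    | @cons u v p a =>
      have h : PathAlgebra.ofPath k ((p.cons a).cons b) =
          PathAlgebra.ofPath k p * PathAlgebra.ofPath k ((Path.nil.cons a).cons b) := by
        rw [PathAlgebra.mul_def, PathAlgebra.mulₗ_comp]
        rfl
      rw [RadSqZero.ofPath, Ideal.Quotient.eq_zero_iff_mem, TwoSidedIdeal.mem_asIdeal, h]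
      exact TwoSidedIdeal.mul_mem_left _ _ _
        (TwoSidedIdeal.subset_span ⟨_, _, _, by simp, rfl⟩)

@[simp]
theorem loopA_mul_loopA : loopA k * loopA k = 0 := by
  rw [loopA, RadSqZero.ofPath, ← map_mul, PathAlgebra.mul_def, PathAlgebra.mulₗ_comp]
  exact RadSqZero.ofPath_eq_zero k _ (by simp)

/-- Both sides are linear, so it is enough to look at paths: the trivial one, the loop, and the
longer ones, which vanish in the quotient. Later computations in the algebra reduce to this normal
form. -/
theorem loopAlgebra_eq (x : LoopAlgebra k) :
    x = vertexCoeff k x • 1 + loopCoeff k x • loopA k := by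
  obtain ⟨x, rfl⟩ := Ideal.Quotient.mk_surjective x
  induction x using PathAlgebra.induction_on with
  | h0 => simp
  | hadd x y hx hy =>
    rw [map_add, map_add, map_add, add_smul, add_smul]
    nth_rewrite 1 [hx, hy]
    abel
  | hpath c i j p =>
    have hs : (Ideal.Quotient.mk (pathsTwoIdeal k (SingleObj Unit)).asIdeal
        (c • PathAlgebra.ofPath k p) : LoopAlgebra k) = c • RadSqZero.ofPath k p := rfl
    rw [hs, map_smul, map_smul, smul_assoc, smul_assoc, ← smul_add]
    congr 1
    cases p with
    | nil =>
      have h : RadSqZero.ofPath k (Path.nil : Path i i) = 1 := loopE_eq_one k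
      simp [h]
    | cons p b =>
      cases p with
      | nil =>
        have h : RadSqZero.ofPath k ((Path.nil : Path i i).cons b) = loopA k := rfl
        simp [h]
      | cons p a => simp [RadSqZero.ofPath_eq_zero k ((p.cons a).cons b) (by simp)]

theorem loopA_mul (x : LoopAlgebra k) : loopA k * x = vertexCoeff k x • loopA k := by
  conv_lhs => rw [loopAlgebra_eq k x]
  simp [mul_add]

theorem mul_loopA (x : LoopAlgebra k) : x * loopA k = vertexCoeff k x • loopA k := by
  conv_lhs => rw [loopAlgebra_eq k x]
  simp [add_mul]

theorem loopA_ne_zero : loopA k ≠ 0 := fun h => by simpa [h] using loopCoeff_loopA k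

/-- A Leibniz rule: `loopCoeff` is a derivation into `k`, on which the algebra acts through the
augmentation `vertexCoeff`. This is why `loopCup` is compatible with the differentials. -/
theorem loopCoeff_mul (x y : LoopAlgebra k) :
    loopCoeff k (x * y) = vertexCoeff k x * loopCoeff k y + loopCoeff k x * vertexCoeff k y := by
  conv_lhs => rw [loopAlgebra_eq k x, loopAlgebra_eq k y]
  simp [add_mul, mul_add]
  ring

end LoopAlgebra

/-! ### Twisted differentials and reduction of cocycles to the cochains `(a^n, y)` -/

section TwistedDifferential

open Quiver

variable {k : Type*} [Field k]

/-- The endomorphism of the algebra `kQ / <Q_2>` which multiplies the loop by `ε`. -/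
noncomputable def loopScale (ε : k) (x : LoopAlgebra k) : LoopAlgebra k :=
  vertexCoeff k x • 1 + (ε * loopCoeff k x) • loopA k

theorem loopScale_one (x : LoopAlgebra k) : loopScale 1 x = x := by
  rw [loopScale, one_mul, ← loopAlgebra_eq]

/-- The Hochschild differential with coefficients in the bimodule `kQ / <Q_2>` whose left action
is twisted by `loopScale ε`. -/
noncomputable def dTwist (ε : k) {n : ℕ} (F : (Fin n → LoopAlgebra k) → LoopAlgebra k)
    (x : Fin (n + 1) → LoopAlgebra k) : LoopAlgebra k :=
  dPre k F x + (loopScale ε (x 0) - x 0) * F (Fin.tail x)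

theorem dTwist_one {n : ℕ} (F : (Fin n → LoopAlgebra k) → LoopAlgebra k) :
    dTwist 1 F = dPre k F := by
  funext x
  rw [dTwist, loopScale_one, sub_self, zero_mul, add_zero]

theorem dTwist_zero (ε : k) (F : (Fin 0 → LoopAlgebra k) → LoopAlgebra k)
    (x : Fin 1 → LoopAlgebra k) :
    dTwist ε F x = loopScale ε (x 0) * F Fin.elim0 - F Fin.elim0 * x 0 := by
  rw [dTwist, dPre_zero, show Fin.tail x = Fin.elim0 from Subsingleton.elim _ _, sub_mul]
  abel

/-- The twist on the right hand side is arbitrary. -/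
theorem dTwist_succ (ε δ : k) {n : ℕ} (F : (Fin (n + 1) → LoopAlgebra k) → LoopAlgebra k)
    (x₀ x₁ : LoopAlgebra k) (r : Fin n → LoopAlgebra k) :
    dTwist ε F (Fin.cons x₀ (Fin.cons x₁ r : Fin (n + 1) → LoopAlgebra k)) =
      loopScale ε x₀ * F (Fin.cons x₁ r) - F (Fin.cons (x₀ * x₁) r)
        + loopScale δ x₁ * F (Fin.cons x₀ r)
        - dTwist δ (fun y : Fin n → LoopAlgebra k => F (Fin.cons x₀ y)) (Fin.cons x₁ r) := by
  -- The term in `loopScale δ x₁` occurs once explicitly and once inside `dTwist δ`, with opposite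
  -- signs, which is why `δ` is free.
  simp only [dTwist, dPre_succ, Fin.cons_zero, Fin.tail_cons, sub_mul]
  abel

theorem dTwist_sub (ε : k) {n : ℕ} (F G : (Fin n → LoopAlgebra k) → LoopAlgebra k)
    (x : Fin (n + 1) → LoopAlgebra k) :
    dTwist ε (fun y => F y - G y) x = dTwist ε F x - dTwist ε G x := by
  simp only [dTwist, dPre_sub, mul_sub]
  abel

theorem dTwist_smul (ε c : k) {n : ℕ} (F : (Fin n → LoopAlgebra k) → LoopAlgebra k)
    (x : Fin (n + 1) → LoopAlgebra k) :
    dTwist ε (fun y => c • F y) x = c • dTwist ε F x := by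
  simp only [dTwist, dPre, mul_smul_comm, smul_mul_assoc, smul_add, Finset.smul_sum]
  simp only [smul_comm c]

theorem loopA_commute (x : LoopAlgebra k) : x * loopA k = loopA k * x := by
  rw [mul_loopA, loopA_mul]

/-- The loop is central, so multiplication by it is a map of bimodules, also for the twisted left
action. -/
theorem dTwist_loopA_mul (ε : k) {n : ℕ} (F : (Fin n → LoopAlgebra k) → LoopAlgebra k)
    (x : Fin (n + 1) → LoopAlgebra k) :
    dTwist ε (fun y => loopA k * F y) x = loopA k * dTwist ε F x := by
  refine Fin.consCases (fun x₀ r => ?_) x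
  rw [dTwist, dTwist, dPre_left_mul, loopA_commute x₀, sub_self, zero_mul, add_zero, mul_add,
    ← mul_assoc, ← mul_assoc, loopA_commute]

/-- The cochain `(x₀, r) ↦ λ(x₀) f(r)`. -/
noncomputable def loopCup {n : ℕ} (f : Cochain k (LoopAlgebra k) n) :
    Cochain k (LoopAlgebra k) (n + 1) :=
  ((loopCoeff k).smulRight (show MultilinearMap k (fun _ : Fin n => LoopAlgebra k)
    (LoopAlgebra k) from f)).uncurryLeft

theorem loopCup_cons {n : ℕ} (f : Cochain k (LoopAlgebra k) n) (x₀ : LoopAlgebra k)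
    (r : Fin n → LoopAlgebra k) : loopCup f (Fin.cons x₀ r) = loopCoeff k x₀ • f r := rfl

theorem loopCochain_cons (n : ℕ) (y x₀ : LoopAlgebra k) (r : Fin n → LoopAlgebra k) :
    loopCochain k (n + 1) y (Fin.cons x₀ r) = loopCoeff k x₀ • loopCochain k n y r := by
  simp only [loopCochain_apply, Fin.prod_univ_succ, Fin.cons_zero, Fin.cons_succ, mul_smul]

/-- `loopCup` anticommutes with the differentials, up to a sign of the twist. -/
theorem dTwist_loopCup (ε : k) {n : ℕ} (f : Cochain k (LoopAlgebra k) n) (x₀ : LoopAlgebra k)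
    (x : Fin (n + 1) → LoopAlgebra k) :
    dTwist ε (loopCup f) (Fin.cons x₀ x) = - (loopCoeff k x₀ • dTwist (-ε) f x) := by
  refine Fin.consCases (fun x₁ r => ?_) x
  -- With the free twist equal to `-ε` the first three terms cancel: their `vertexCoeff` parts by
  -- the Leibniz rule, and their loop parts because `ε` and `-ε` multiply the same product `λ(x₀)
  -- λ(x₁)`. Only the last term survives.
  rw [dTwist_succ ε (-ε)]
  simp only [loopCup_cons, dTwist_smul, loopCoeff_mul, loopScale, mul_smul_comm, add_mul,
    smul_mul_assoc, one_mul, smul_add, smul_smul, add_smul]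
  module

/-- `(a^n, y)` is an iterated `loopCup` of `y`. In degree zero the scalar is `ε - 1`, by
commutativity; each `loopCup` flips the twist and the sign, and `-(-ε - (-1)^n) = ε - (-1)^(n+1)`.
-/
theorem dTwist_loopCochain (ε : k) (n : ℕ) (y : LoopAlgebra k)
    (x : Fin (n + 1) → LoopAlgebra k) :
    dTwist ε (loopCochain k n y) x =
      (ε - (-1) ^ n) • loopCochain k (n + 1) (loopA k * y) x := by
  induction n generalizing ε with
  | zero =>
    rw [dTwist_zero, loopCochain_apply, loopCochain_apply]
    simp only [Finset.univ_eq_empty, Finset.prod_empty, one_smul, Fin.prod_univ_succ, mul_one,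
      pow_zero]
    nth_rewrite 2 [loopAlgebra_eq k (x 0)]
    simp only [loopScale, add_mul, mul_add, smul_mul_assoc, mul_smul_comm, one_mul, mul_one,
      loopA_commute]
    module
  | succ n ih =>
    refine Fin.consCases (fun x₀ x => ?_) x
    have h : ⇑(loopCochain k (n + 1) y) = loopCup (loopCochain k n y) := by
      funext z
      refine Fin.consCases (fun z₀ r => ?_) z
      rw [loopCochain_cons, loopCup_cons]
    rw [h, dTwist_loopCup, ih, loopCochain_cons _ _ x₀]
    rw [pow_succ]
    module

theorem cons_eq_fixFirst {n : ℕ} (f : Cochain k (LoopAlgebra k) (n + 1)) (x₀ : LoopAlgebra k)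
    (r : Fin n → LoopAlgebra k) :
    f (Fin.cons x₀ r) =
      vertexCoeff k x₀ • fixFirst f 1 r + loopCoeff k x₀ • fixFirst f (loopA k) r := by
  have h (c : k) (z : LoopAlgebra k) : f (Fin.cons (c • z) r) = c • f (Fin.cons z r) :=
    MultilinearMap.cons_smul f r c z
  conv_lhs => rw [loopAlgebra_eq k x₀, Cochain.cons_add, h, h]
  rfl

/-- This is the cocycle equation with first argument `1`, where the first two terms of `dTwist_succ`
cancel. For `δ = ε` it shows that `f` and `dTwist ε (fixFirst f 1)` agree when the first argument is
`1`; for `δ = -ε` it serves in `dTwist_fixFirst_loopA`. -/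
theorem dTwist_fixFirst_one {ε : k} {n : ℕ} {f : Cochain k (LoopAlgebra k) (n + 1)}
    (hf : ∀ x, dTwist ε f x = 0) (δ : k) (x₁ : LoopAlgebra k) (r : Fin n → LoopAlgebra k) :
    dTwist δ (fixFirst f 1) (Fin.cons x₁ r) = loopScale δ x₁ * fixFirst f 1 r := by
  have h := hf (Fin.cons 1 (Fin.cons x₁ r : Fin (n + 1) → LoopAlgebra k))
  rw [dTwist_succ ε δ] at h
  simp only [loopScale, vertexCoeff_one, loopCoeff_one, one_smul, mul_zero, zero_smul, add_zero,
    one_mul, sub_self, zero_add] at h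
  exact (sub_eq_zero.mp h).symm

/-- The function here is the coefficient of `λ(x₀)` in `f - dTwist ε (fixFirst f 1)`, the cochain to
which the induction is applied. That it is a cocycle for the opposite twist comes from the cocycle
equation with first argument `a`, together with `a * a = 0`. -/
theorem dTwist_fixFirst_loopA {ε : k} {n : ℕ} {f : Cochain k (LoopAlgebra k) (n + 1)}
    (hf : ∀ x, dTwist ε f x = 0) (x : Fin (n + 1) → LoopAlgebra k) :
    dTwist (-ε) (fun r => fixFirst f (loopA k) r - ε • (loopA k * fixFirst f 1 r)) x = 0 := by
  refine Fin.consCases (fun x₁ r => ?_) x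
  have h := hf (Fin.cons (loopA k) (Fin.cons x₁ r : Fin (n + 1) → LoopAlgebra k))
  rw [dTwist_succ ε (-ε)] at h
  rw [dTwist_sub, dTwist_smul, dTwist_loopA_mul, dTwist_fixFirst_one hf]
  rw [sub_eq_zero] at h
  rw [show dTwist (-ε) (fixFirst f (loopA k)) (Fin.cons x₁ r) = _ from h.symm]
  have e : f (Fin.cons (loopA k) r) = fixFirst f (loopA k) r := rfl
  rw [cons_eq_fixFirst f x₁, cons_eq_fixFirst f (loopA k * x₁), e, loopA_mul]
  simp only [loopScale, vertexCoeff_loopA, loopCoeff_loopA, map_smul, zero_smul, smul_zero,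
    zero_add, add_mul, mul_add, smul_mul_assoc, mul_smul_comm, one_mul, ← mul_assoc,
    loopA_mul_loopA, zero_mul, smul_eq_mul, mul_one, smul_add]
  module

/-- The product of the loop with a cochain. -/
noncomputable def loopMul {n : ℕ} (f : Cochain k (LoopAlgebra k) n) :
    Cochain k (LoopAlgebra k) n :=
  (LinearMap.mulLeft k (loopA k)).compMultilinearMap
    (show MultilinearMap k (fun _ : Fin n => LoopAlgebra k) (LoopAlgebra k) from f)

/-- A twisted cocycle is cohomologous to a multiple of the cochains `(a^n, y)`. -/
theorem exists_eq_dTwist_add_loopCochain {n : ℕ} (ε : k) (f : Cochain k (LoopAlgebra k) (n + 1))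
    (hf : ∀ x, dTwist ε f x = 0) :
    ∃ (g : Cochain k (LoopAlgebra k) n) (y : LoopAlgebra k),
      ∀ x, f x = dTwist ε g x + loopCochain k (n + 1) y x := by
  induction n generalizing ε with
  | zero =>
    -- After subtracting `dTwist ε (fixFirst f 1)` only a multiple of `λ(x₀)` is left, and its
    -- coefficient is the constant `y`.
    refine ⟨fixFirst f 1, fixFirst f (loopA k) Fin.elim0
      - ε • (loopA k * fixFirst f 1 Fin.elim0), fun x => ?_⟩
    refine Fin.consCases (fun x₀ r => ?_) x
    obtain rfl : r = Fin.elim0 := Subsingleton.elim _ _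
    rw [cons_eq_fixFirst, dTwist_fixFirst_one hf, loopCochain_cons, loopCochain_apply]
    simp only [Finset.univ_eq_empty, Finset.prod_empty, loopScale, add_mul, smul_mul_assoc, one_mul]
    module
  | succ n ih =>
    -- The induction hypothesis needs a multilinear cochain, not just a function; `loopMul` provides
    -- it.
    obtain ⟨c, hc⟩ : ∃ c : Cochain k (LoopAlgebra k) (n + 1),
        ⇑c = fun r => fixFirst f (loopA k) r - ε • (loopA k * fixFirst f 1 r) :=
      ⟨fixFirst f (loopA k) - ε • loopMul (fixFirst f 1), rfl⟩
    obtain ⟨g, y, hg⟩ := ih (-ε) c fun x => by rw [hc, dTwist_fixFirst_loopA hf]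
    -- Here `f = dTwist ε (fixFirst f 1) + loopCup c` and `c` is `dTwist (-ε) g` plus a standard
    -- cochain. The minus sign is that of `dTwist_loopCup`.
    refine ⟨fixFirst f 1 - loopCup g, y, fun x => ?_⟩
    refine Fin.consCases (fun x₀ r => ?_) x
    have hg' := hg r
    simp only [hc, sub_eq_iff_eq_add] at hg'
    rw [show ⇑(fixFirst f 1 - loopCup g) = fun z => fixFirst f 1 z - loopCup g z from rfl,
      dTwist_sub, dTwist_fixFirst_one hf, dTwist_loopCup, cons_eq_fixFirst, hg', loopCochain_cons]
    simp only [loopScale, add_mul, smul_mul_assoc, one_mul]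
    module

end TwistedDifferential

/-! ### Cocycles, coboundaries and generators of the cohomology -/

section LoopCohomology

open Quiver

variable {k : Type*} [Field k]

theorem d_loopCochain (n : ℕ) (y : LoopAlgebra k) :
    d k (LoopAlgebra k) n (loopCochain k n y) =
      (1 - (-1) ^ n : k) • loopCochain k (n + 1) (loopA k * y) := by
  ext x
  rw [d_eq_dPre, ← dTwist_one, dTwist_loopCochain, Cochain.smul_apply]

theorem loopCochain_add (n : ℕ) (y z : LoopAlgebra k) :
    loopCochain k n (y + z) = loopCochain k n y + loopCochain k n z := by
  ext x
  rw [Cochain.add_apply, loopCochain_apply, loopCochain_apply, loopCochain_apply, smul_add]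

theorem loopCochain_smul (n : ℕ) (c : k) (y : LoopAlgebra k) :
    loopCochain k n (c • y) = c • loopCochain k n y := by
  ext x
  rw [Cochain.smul_apply, loopCochain_apply, loopCochain_apply, smul_comm]

theorem loopCochain_loopA (n : ℕ) (y : LoopAlgebra k) :
    loopCochain k n y (fun _ => loopA k) = y := by
  simp [loopCochain_apply]

theorem loopCochain_zero (f : Cochain k (LoopAlgebra k) 0) :
    f = loopCochain k 0 (f Fin.elim0) := by
  ext x
  obtain rfl : x = Fin.elim0 := Subsingleton.elim _ _
  simp [loopCochain_apply]

theorem loopCochain_mem_cocycles_of_even {n : ℕ} (hn : Even n) (y : LoopAlgebra k) :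
    loopCochain k n y ∈ cocycles k (LoopAlgebra k) n := by
  rw [cocycles, LinearMap.mem_ker, d_loopCochain, hn.neg_one_pow, sub_self, zero_smul]

theorem loopCochain_loopA_mem_cocycles (n : ℕ) :
    loopCochain k n (loopA k) ∈ cocycles k (LoopAlgebra k) n := by
  rw [cocycles, LinearMap.mem_ker, d_loopCochain, loopA_mul_loopA,
    show (0 : LoopAlgebra k) = (0 : k) • 0 by simp, loopCochain_smul, zero_smul, smul_zero]

theorem exists_eq_d_add_loopCochain {n : ℕ} {f : Cochain k (LoopAlgebra k) (n + 1)}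
    (hf : f ∈ cocycles k (LoopAlgebra k) (n + 1)) :
    ∃ (g : Cochain k (LoopAlgebra k) n) (u v : k), f = d k (LoopAlgebra k) n g +
      (u • loopCochain k (n + 1) (loopE k) + v • loopCochain k (n + 1) (loopA k)) := by
  obtain ⟨g, y, h⟩ := exists_eq_dTwist_add_loopCochain 1 f fun x => by
    rw [dTwist_one, (mem_cocycles f).mp hf]
  refine ⟨g, vertexCoeff k y, loopCoeff k y, ?_⟩
  rw [← loopCochain_smul, ← loopCochain_smul, ← loopCochain_add, loopE_eq_one, ← loopAlgebra_eq]
  ext x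
  rw [h, dTwist_one, Cochain.add_apply, d_eq_dPre]

/-- On `(a, ..., a)` every inner term contains `a * a = 0`, so only the two outer terms remain.
Hence a coboundary takes there a value in `a A`, and the value zero if `n` is even: these are the
obstructions to being a coboundary. -/
theorem d_apply_loopA {n : ℕ} (g : Cochain k (LoopAlgebra k) n) :
    d k (LoopAlgebra k) n g (fun _ => loopA k) =
      (1 - (-1) ^ n : k) • (loopA k * g fun _ => loopA k) := by
  have hc (i : Fin n) :
      g (Fin.contractNth i.castSucc (· * ·) (fun _ : Fin (n + 1) => loopA k)) = 0 := by
    refine MultilinearMap.map_coord_zero (f := (show MultilinearMap k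
      (fun _ : Fin n => LoopAlgebra k) (LoopAlgebra k) from g)) i ?_
    rw [Fin.contractNth_apply_of_eq _ _ _ _ (by simp), loopA_mul_loopA]
  rw [d_apply]
  simp only [hc, smul_zero, Finset.sum_const_zero, add_zero, loopA_commute]
  rw [pow_succ, sub_smul, one_smul, mul_neg_one, neg_smul, ← sub_eq_add_neg]
  rfl

theorem loopCochain_loopE_notMem_coboundaries (n : ℕ) :
    loopCochain k n (loopE k) ∉ coboundaries k (LoopAlgebra k) n := by
  intro h
  cases n with
  | zero =>
    have h' := loopCochain_loopA 0 (loopE k)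
    rw [show loopCochain k 0 (loopE k) = 0 from h, Cochain.zero_apply, loopE_eq_one] at h'
    exact loopA_ne_zero k (by rw [← mul_one (loopA k), ← h', mul_zero])
  | succ n =>
    obtain ⟨g, hg⟩ := h
    have h' := d_apply_loopA g
    rw [hg, loopCochain_loopA, loopE_eq_one] at h'
    -- Multiplying by `a` kills the side coming from the coboundary and turns `1` into `a`, whatever
    -- the parity of `n`.
    have h'' := congrArg (loopA k * ·) h'
    simp only [mul_one, mul_smul_comm, ← mul_assoc, loopA_mul_loopA, zero_mul, smul_zero] at h''
    exact loopA_ne_zero k h''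

theorem loopCochain_loopA_notMem_coboundaries {n : ℕ} (hn : Odd n) :
    loopCochain k n (loopA k) ∉ coboundaries k (LoopAlgebra k) n := by
  intro h
  cases n with
  | zero => simp at hn
  | succ n =>
    obtain ⟨g, hg⟩ := h
    have h' := d_apply_loopA g
    -- The primitive `g` lives one degree lower, in even degree, where the factor `1 - (-1)^n`
    -- vanishes.
    rw [hg, loopCochain_loopA, (by grind : Even n).neg_one_pow, sub_self, zero_smul] at h'
    exact loopA_ne_zero k h'

theorem span_mk_loopE_eq_top [CharZero k] {n : ℕ} (hn : Even n) (h0 : 0 < n)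
    (z : cocycles k (LoopAlgebra k) n)
    (hz : (z : Cochain k (LoopAlgebra k) n) = loopCochain k n (loopE k)) :
    Submodule.span k {HH.mk z} = ⊤ := by
  obtain ⟨n, rfl⟩ := Nat.exists_eq_succ_of_ne_zero h0.ne'
  rw [Submodule.eq_top_iff']
  intro x
  obtain ⟨f, rfl⟩ := HH.mk_surjective x
  obtain ⟨g, u, v, hf⟩ := exists_eq_d_add_loopCochain f.2
  refine Submodule.mem_span_singleton.mpr ⟨u, ?_⟩
  rw [← map_smul, ← sub_eq_zero, ← map_sub, HH.mk_eq_zero_iff]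
  -- A primitive of `u • z - f`. The degree `n` is now the odd predecessor, where `d (a^n, e) = 2
  -- (a^(n+1), a)`, so half of `v` absorbs the `(a^(n+1), a)` component.
  refine ⟨-(g + (v / 2) • loopCochain k n (loopE k)), ?_⟩
  have h2 : (2 : k) ≠ 0 := two_ne_zero
  have hd : d k (LoopAlgebra k) n (loopCochain k n (loopE k)) =
      (2 : k) • loopCochain k (n + 1) (loopA k) := by
    rw [d_loopCochain, loopE_eq_one, mul_one, (by grind : Odd n).neg_one_pow]
    norm_num
  rw [map_neg, map_add, map_smul, hd, smul_smul, div_mul_cancel₀ _ h2]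
  push_cast
  rw [hz, hf]
  abel

theorem span_mk_loopA_eq_top [CharZero k] {n : ℕ} (hn : Odd n)
    (z : cocycles k (LoopAlgebra k) n)
    (hz : (z : Cochain k (LoopAlgebra k) n) = loopCochain k n (loopA k)) :
    Submodule.span k {HH.mk z} = ⊤ := by
  obtain ⟨n, rfl⟩ := Nat.exists_eq_succ_of_ne_zero hn.pos.ne'
  rw [Submodule.eq_top_iff']
  intro x
  obtain ⟨f, rfl⟩ := HH.mk_surjective x
  obtain ⟨g, u, v, hf⟩ := exists_eq_d_add_loopCochain f.2
  -- Applying `d` to the decomposition of the cocycle `f` leaves `2 u` times `(a^(n+2), a)`;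
  -- evaluation at `(a, ..., a)` and characteristic zero give `u = 0`.
  have hu : u = 0 := by
    have h : d k (LoopAlgebra k) (n + 1) f = 0 := f.2
    have hdd : d k (LoopAlgebra k) (n + 1) (d k (LoopAlgebra k) n g) = 0 :=
      LinearMap.congr_fun (d_comp_d k (LoopAlgebra k) n) g
    have ha : d k (LoopAlgebra k) (n + 1) (loopCochain k (n + 1) (loopA k)) = 0 :=
      loopCochain_loopA_mem_cocycles (n + 1)
    rw [hf, map_add, hdd, map_add, map_smul, map_smul, ha, d_loopCochain, hn.neg_one_pow,
      loopE_eq_one, mul_one, smul_zero, add_zero, zero_add] at h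
    have h' := loopCochain_loopA (k := k) (n + 2) (loopA k)
    have h'' := congrArg (fun F : Cochain k (LoopAlgebra k) (n + 2) => F fun _ => loopA k) h
    simp only [Cochain.smul_apply, h', Cochain.zero_apply, smul_eq_zero, loopA_ne_zero,
      or_false] at h''
    norm_num at h''
    exact h''
  refine Submodule.mem_span_singleton.mpr ⟨v, ?_⟩
  rw [← map_smul, ← sub_eq_zero, ← map_sub, HH.mk_eq_zero_iff]
  refine ⟨-g, ?_⟩
  push_cast
  rw [hz, hf, hu, map_neg, zero_smul]
  abel

/-! ### The action of the Euler derivation and one dimensional Lie modules -/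

/-- The action of the Euler derivation `(a, a)` on the cochains `(a^n, y)`. -/
theorem bracket_loopCochain (n : ℕ) (y : LoopAlgebra k) :
    bracket (Nat.add_comm n 1) (loopCochain k 1 (loopA k)) (loopCochain k n y) =
      loopCochain k n (loopCoeff k y • loopA k - (n : k) • y) := by
  ext x
  have hD (b : LoopAlgebra k) :
      toEnd (loopCochain k 1 (loopA k)) b = loopCoeff k b • loopA k := by
    simp [toEnd_apply, loopCochain_apply]
  -- The cochain sees `x i` only through `λ(x i)`, which is also the `λ` of `λ(x i) a`. So each of
  -- the `n` summands of the action returns the cochain itself, whence the term `-n`.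
  have hi (i : Fin n) : loopCochain k n y (Function.update x i (loopCoeff k (x i) • loopA k)) =
      loopCochain k n y x := by
    rw [loopCochain_apply, loopCochain_apply]
    congr 1
    refine Finset.prod_congr rfl fun j _ => ?_
    rcases eq_or_ne j i with rfl | hj
    · simp
    · rw [Function.update_of_ne hj]
  rw [bracket_one_apply, actPre]
  simp only [hD, hi, Finset.sum_const, Finset.card_univ, Fintype.card_fin]
  rw [loopCochain_apply, loopCochain_apply, map_smul, smul_eq_mul, ← Nat.cast_smul_eq_nsmul k]
  module

/-- The hypothesis `hy` says that `y` is an eigenvector of the Euler derivation shifted by `-n`: the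
eigenvalue is `-n` for `y = e` and `1 - n` for `y = a`. -/
theorem lie_mk_loopCochain {n : ℕ} {y : LoopAlgebra k} {c : k}
    (hy : loopCoeff k y • loopA k - (n : k) • y = c • y)
    (aa : cocycles k (LoopAlgebra k) 1)
    (haa : (aa : Cochain k (LoopAlgebra k) 1) = loopCochain k 1 (loopA k))
    (z : cocycles k (LoopAlgebra k) n)
    (hz : (z : Cochain k (LoopAlgebra k) n) = loopCochain k n y) :
    ⁅HH.mk aa, HH.mk z⁆ = c • HH.mk z := by
  rw [HH.lie_mk, ← map_smul]
  congr 1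
  apply Subtype.ext
  rw [coe_bracketCocycles, haa, hz, bracket_loopCochain, hy, loopCochain_smul]
  push_cast
  rw [hz]

theorem finrank_eq_one_of_span_singleton {V : Type*} [AddCommGroup V] [Module k V] {v : V}
    (h0 : v ≠ 0) (h : Submodule.span k {v} = ⊤) : Module.finrank k V = 1 :=
  finrank_eq_one v h0 fun _ => Submodule.mem_span_singleton.mp (h ▸ Submodule.mem_top)

theorem exists_equiv_of_span_singleton {V : Type*} [AddCommGroup V] [Module k V] {v : V}
    (h0 : v ≠ 0) (h : Submodule.span k {v} = ⊤) : ∃ e : V ≃ₗ[k] k, e v = 1 := by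
  let e := (LinearEquiv.toSpanNonzeroSingleton k V v h0).trans (LinearEquiv.ofTop _ h)
  refine ⟨e.symm, ?_⟩
  rw [LinearEquiv.symm_apply_eq]
  simp [e]

/-- A one dimensional module over a one dimensional Lie algebra, on which a generator acts by a
nonzero scalar, is the standard module over `gl_1`. -/
theorem exists_standard_module_of_span_singleton {L M : Type*} [LieRing L] [LieAlgebra k L]
    [AddCommGroup M] [Module k M] [LieRingModule L M] [LieModule k L M] {x : L} {y : M} {c : k}
    (hc : c ≠ 0) (hx0 : x ≠ 0) (hx : Submodule.span k {x} = ⊤) (hy0 : y ≠ 0)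
    (hy : Submodule.span k {y} = ⊤) (hxy : ⁅x, y⁆ = c • y) :
    ∃ (φ : L ≃ₗ[k] k) (ψ : M ≃ₗ[k] k),
      (∀ u v : L, φ ⁅u, v⁆ = φ u * φ v - φ v * φ u) ∧
      ∀ (u : L) (v : M), ψ ⁅u, v⁆ = φ u * ψ v := by
  obtain ⟨φ, hφ⟩ := exists_equiv_of_span_singleton hx0 hx
  obtain ⟨ψ, hψ⟩ := exists_equiv_of_span_singleton hy0 hy
  have eL (u : L) : u = φ u • x := φ.injective (by simp [hφ])
  have eM (v : M) : v = ψ v • y := ψ.injective (by simp [hψ])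
  -- The coordinate on `L` is rescaled so that the generator `x` goes to `c`, the scalar by which it
  -- acts; `ψ` needs no rescaling. Brackets in `L` vanish, as do commutators in `k`.
  refine ⟨φ.trans (LinearEquiv.smulOfNeZero k k c hc), ψ, fun u v => ?_, fun u v => ?_⟩
  · rw [eL u, eL v, smul_lie, lie_smul, lie_self]
    simp [mul_comm]
  · conv_lhs => rw [eL u, eM v, smul_lie, lie_smul, hxy]
    simp [hψ]
    ring

end LoopCohomology

/-! ### Assembly of the statements -/

theorem mainTheorem7 (k : Type*) [Field k] [CharZero k] :
    -- `HH^1(A)` is a one dimensional abelian Lie algebra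
    Module.finrank k (HH k (LoopAlgebra k) 1) = 1 ∧
    IsLieAbelian (HH k (LoopAlgebra k) 1) ∧
    -- `HH^n(A)` is one dimensional for `n > 0`
    (∀ n : ℕ, 0 < n → Module.finrank k (HH k (LoopAlgebra k) n) = 1) ∧
    -- the generator `(a, a)` of `HH^1(A)`
    (∃ aa : cocycles k (LoopAlgebra k) 1,
      (aa : Cochain k (LoopAlgebra k) 1) = loopCochain k 1 (loopA k) ∧
      Submodule.span k {HH.mk aa} = ⊤ ∧
      -- `n` even: the class of `(a^n, e)`, which generates `HH^n(A)` if `n > 0`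
      (∀ n : ℕ, Even n → ∃ z : cocycles k (LoopAlgebra k) n,
        (z : Cochain k (LoopAlgebra k) n) = loopCochain k n (loopE k) ∧
        HH.mk z ≠ 0 ∧
        (0 < n → Submodule.span k {HH.mk z} = ⊤) ∧
        ⁅HH.mk aa, HH.mk z⁆ = (-(n : k)) • HH.mk z) ∧
      -- `n` odd: the class of `(a^n, a)`, which generates `HH^n(A)`
      (∀ n : ℕ, Odd n → ∃ z : cocycles k (LoopAlgebra k) n,
        (z : Cochain k (LoopAlgebra k) n) = loopCochain k n (loopA k) ∧
        HH.mk z ≠ 0 ∧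
        Submodule.span k {HH.mk z} = ⊤ ∧
        ⁅HH.mk aa, HH.mk z⁆ = (-((n : k) - 1)) • HH.mk z) ∧
      -- degree zero: `HH^0(A)` has the basis `e`, `a`, and `(a, a)` acts on `a` by `1`
      (∃ z z' : cocycles k (LoopAlgebra k) 0,
        (z : Cochain k (LoopAlgebra k) 0) = loopCochain k 0 (loopE k) ∧
        (z' : Cochain k (LoopAlgebra k) 0) = loopCochain k 0 (loopA k) ∧
        LinearIndependent k ![HH.mk z, HH.mk z'] ∧
        Submodule.span k {HH.mk z, HH.mk z'} = ⊤ ∧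
        ⁅HH.mk aa, HH.mk z'⁆ = HH.mk z')) ∧
    -- for `n > 1` the module `HH^n(A)` is the standard module `k` over the Lie algebra `k = gl_1(k)`
    (∀ n : ℕ, 1 < n → ∃ (φ : HH k (LoopAlgebra k) 1 ≃ₗ[k] k) (ψ : HH k (LoopAlgebra k) n ≃ₗ[k] k),
      (∀ x x' : HH k (LoopAlgebra k) 1, φ ⁅x, x'⁆ = φ x * φ x' - φ x' * φ x) ∧
      ∀ (x : HH k (LoopAlgebra k) 1) (y : HH k (LoopAlgebra k) n), ψ ⁅x, y⁆ = φ x * ψ y) := by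
  let aa : cocycles k (LoopAlgebra k) 1 := ⟨_, loopCochain_loopA_mem_cocycles 1⟩
  have haa : HH.mk aa ≠ 0 := fun h =>
    loopCochain_loopA_notMem_coboundaries odd_one ((HH.mk_eq_zero_iff _).mp h)
  have hspan : Submodule.span k {HH.mk aa} = ⊤ := span_mk_loopA_eq_top odd_one aa rfl
  have heven (n : ℕ) (hn : Even n) : ∃ z : cocycles k (LoopAlgebra k) n,
      (z : Cochain k (LoopAlgebra k) n) = loopCochain k n (loopE k) ∧ HH.mk z ≠ 0 ∧
      (0 < n → Submodule.span k {HH.mk z} = ⊤) ∧ ⁅HH.mk aa, HH.mk z⁆ = (-(n : k)) • HH.mk z := by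
    refine ⟨⟨_, loopCochain_mem_cocycles_of_even hn _⟩, rfl, fun h => ?_, fun h0 => ?_, ?_⟩
    · exact loopCochain_loopE_notMem_coboundaries n ((HH.mk_eq_zero_iff _).mp h)
    · exact span_mk_loopE_eq_top hn h0 _ rfl
    · exact lie_mk_loopCochain (by simp [loopE_eq_one]) aa rfl _ rfl
  have hodd (n : ℕ) (hn : Odd n) : ∃ z : cocycles k (LoopAlgebra k) n,
      (z : Cochain k (LoopAlgebra k) n) = loopCochain k n (loopA k) ∧ HH.mk z ≠ 0 ∧
      Submodule.span k {HH.mk z} = ⊤ ∧ ⁅HH.mk aa, HH.mk z⁆ = (-((n : k) - 1)) • HH.mk z := by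
    refine ⟨⟨_, loopCochain_loopA_mem_cocycles n⟩, rfl, fun h => ?_, ?_, ?_⟩
    · exact loopCochain_loopA_notMem_coboundaries hn ((HH.mk_eq_zero_iff _).mp h)
    · exact span_mk_loopA_eq_top hn _ rfl
    · refine lie_mk_loopCochain ?_ aa rfl _ rfl
      rw [loopCoeff_loopA]
      module
  have hrank (n : ℕ) (hn : 0 < n) : Module.finrank k (HH k (LoopAlgebra k) n) = 1 := by
    rcases n.even_or_odd with h | h
    · obtain ⟨z, -, h0, hs, -⟩ := heven n h
      exact finrank_eq_one_of_span_singleton h0 (hs hn)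
    · obtain ⟨z, -, h0, hs, -⟩ := hodd n h
      exact finrank_eq_one_of_span_singleton h0 hs
  refine ⟨hrank 1 one_pos, ⟨fun x y => ?_⟩, hrank, ⟨aa, rfl, hspan, heven, hodd, ?_⟩,
    fun n hn => ?_⟩
  · obtain ⟨b, rfl⟩ := Submodule.mem_span_singleton.mp
      (hspan ▸ Submodule.mem_top : x ∈ Submodule.span k {HH.mk aa})
    obtain ⟨c, rfl⟩ := Submodule.mem_span_singleton.mp
      (hspan ▸ Submodule.mem_top : y ∈ Submodule.span k {HH.mk aa})
    rw [smul_lie, lie_smul, lie_self, smul_zero, smul_zero]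
  -- In degree zero the coboundaries are `⊥`, so equations between classes are equations between
  -- elements of the algebra.
  · have hmk (w : cocycles k (LoopAlgebra k) 0) (h : HH.mk w = 0) : w = 0 :=
      Subtype.ext ((HH.mk_eq_zero_iff w).mp h)
    refine ⟨⟨_, loopCochain_mem_cocycles_of_even Even.zero _⟩,
      ⟨_, loopCochain_loopA_mem_cocycles 0⟩, rfl, rfl, ?_, ?_, ?_⟩
    · rw [LinearIndependent.pair_iff]
      intro s t h
      rw [← map_smul, ← map_smul, ← map_add] at h
      have h' := congrArg (fun w : cocycles k (LoopAlgebra k) 0 =>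
        (w : Cochain k (LoopAlgebra k) 0) fun _ => loopA k) (hmk _ h)
      have h1 : s • loopE k + t • loopA k = 0 := by
        rw [← loopCochain_loopA 0 (loopE k), ← loopCochain_loopA 0 (loopA k)]
        exact h'
      rw [loopE_eq_one] at h1
      exact ⟨by simpa using congrArg (vertexCoeff k) h1, by simpa using congrArg (loopCoeff k) h1⟩
    · rw [Submodule.eq_top_iff']
      intro x
      obtain ⟨f, rfl⟩ := HH.mk_surjective x
      refine Submodule.mem_span_pair.mpr ⟨vertexCoeff k (f.1 Fin.elim0),
        loopCoeff k (f.1 Fin.elim0), ?_⟩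
      rw [← map_smul, ← map_smul, ← map_add]
      congr 1
      apply Subtype.ext
      push_cast
      rw [← loopCochain_smul, ← loopCochain_smul, ← loopCochain_add, loopE_eq_one,
        ← loopAlgebra_eq, ← loopCochain_zero]
    · refine (lie_mk_loopCochain (c := 1) ?_ aa rfl _ rfl).trans (one_smul k _)
      simp
  · rcases n.even_or_odd with h | h
    · obtain ⟨z, -, h0, hs, hz⟩ := heven n h
      exact exists_standard_module_of_span_singleton
        -- Characteristic zero makes the eigenvalue `-n` nonzero.
        (neg_ne_zero.mpr (Nat.cast_ne_zero.mpr (by omega))) haa hspan h0 (hs (by omega)) hz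
    · obtain ⟨z, -, h0, hs, hz⟩ := hodd n h
      refine exists_standard_module_of_span_singleton (neg_ne_zero.mpr ?_) haa hspan h0 hs hz
      -- The eigenvalue `-(n - 1)` vanishes exactly for `n = 1`, which `1 < n` excludes.
      rw [sub_ne_zero]
      exact_mod_cast hn.ne'
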